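/- **Setting.** Let $d\in\mathbb N$ and $\tau>d/2$. Let $\Phi:\mathbb R^d\to\mathbb R$ be a continuous radial function supported in the closed unit ball with $c_\Phi(1+\|\omega\|_2^2)^{-\tau}\le\widehat\Phi(\omega)\le C_\Phi(1+\|\omega\|_2^2)^{-\tau}$ for all $\omega\in\mathbb R^d$, where $c_\Phi,C_\Phi>0$ and $\widehat\Phi(\omega)=(2\pi)^{-d/2}\int\Phi(x)e^{-ix\cdot\omega}\,dx$. Put $\Phi_\delta(x)=\delta^{-d}\Phi(x/\delta)$. Let $\Omega\subset\mathbb R^d$ be a nonempty bounded open set and, for $\ell\ge1$, let $X_\ell=\{x^{(\ell)}_1,\dots,x^{(\ell)}_{N(\ell)}\}\subset\Omega$ have fill distance $h_\ell=\sup_{y\in\Omega}\min_j\|y-x_j^{(\ell)}\|_2$ and separation distance $q_\ell=\frac12\min_{j\ne k}\|x_j^{(\ell)}-x_k^{(\ell)}\|_2$. Assume that there are $\mu\in(0,1)$, $c_h\in(0,1]$, $c_q$ and $c_\#>0$ such that for all $\ell\ge1$ $$c_h\mu h_\ell\le h_{\ell+1}\le\mu h_\ell,\qquad q_\ell\le h_\ell\le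 c_qq_\ell,\qquad c_\#\mu^{-d\ell}\le N(\ell),$$ and that $\mu^{-d}>2$. Let $\delta_\ell=\nu h_\ell$ with $\nu\ge1/h_1$. Let $B_{k\ell}=(\Phi_{\delta_\ell}(x_i^{(k)}-x_j^{(\ell)}))_{i,j}$ and $A_\ell=B_{\ell\ell}$. For $L\ge1$ let $T'_L$ be the block lower triangular matrix with blocks $k,\ell\in\{1,\dots,L\}$, identity blocks on the diagonal and the blocks $B_{k\ell}A_\ell^{-1}$ for $k>\ell$. Let $M=\mathrm{id}-T'_L$. For $T>0$ let $\tilde M(T)$ arise from $M$ by setting to zero every entry (row point $x_i^{(k)}$, column point $x_j^{(\ell)}$) with $\|x_i^{(k)}-x_j^{(\ell)}\|_2\ge Tq_\ell$. Let $f$ be continuous and bounded on $\Omega$ and $\mathbf f=(f|_{X_1},\dots,f|_{X_L})$. **Constants.** Put $$M_d=12\Big(\tfrac{\pi\Gamma(\frac d2+1)^2}{9}\Big)^{\frac1{d+1}},\quad C_d=\tfrac1{2\Gamma(\frac d2+1)}\Big(\tfrac{M_d}{2^{3/2}}\Big)^d,\quad K=\Phi(0)(C_dc_\Phi)^{-1}(1+4M_d^2\nu^2c_q^2)^\tau,\quad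 z=4^dK,$$ $$\theta=-\tfrac1{2\sqrt d\max\{c_q\nu,4\}}\log\tfrac{\sqrt z-1}{\sqrt z+1},\quad C=2K\,e^{2\theta\sqrt d}e^{c_q\nu\theta}(1+\nu c_q)^d,\quad C_\Sigma=\sum_{m=0}^\infty(m+2)^de^{-\theta m}.$$ **Theorem.** Suppose that $L$ and $T$ are large enough that $$2\,C\,C_\Sigma\,L\,e^{\theta/L}\,c_q^{\frac d{2L}+\frac d2}\le(c_h\mu)^{-dL/2}\qquad\text{and}\qquad T^d\le e^{\frac\theta2T}.$$ Let $\beta_L,\tilde\beta_L$ be the $L$-th iterates of the Jacobi iterations $\beta_{m+1}=\mathbf f+M\beta_m$ and $\tilde\beta_{m+1}=\mathbf f+\tilde M(T)\tilde\beta_m$ with an arbitrary common starting vector $\beta_0=\tilde\beta_0$. Then $$\|\beta_L-\tilde\beta_L\|_2\le\sqrt{N(1)}\;e^{-\frac\theta2T}\,(c_h\mu)^{-dL^2}\,\|f\|_{L_\infty(\Omega)}.$$ The same bound holds for $\|\beta-\tilde\beta\|_2$ if $\beta$ and $\tilde\beta$ are the solutions of $T'_L\beta=\mathbf f$ and $(\mathrm{id}-\tilde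 M(T))\tilde\beta=\mathbf f$. -/

import Mathlib

open MeasureTheory Matrix
open scoped FourierTransform

noncomputable section

namespace Multiscale

/-! ### Kernels -/

/-- The Fourier transform `(2π)^(-d/2) ∫ Φ(x) exp(-i x·ω) dx`, through Mathlib's `𝓕`, whose
frequency variable is `ω / (2π)`.  For the even functions considered here it is real valued. -/
def fourierHat {d : ℕ} (Φ : EuclideanSpace ℝ (Fin d) → ℝ) (ω : EuclideanSpace ℝ (Fin d)) : ℝ :=
  (2 * Real.pi) ^ (-(d : ℝ) / 2) *
    (𝓕 (fun x : EuclideanSpace ℝ (Fin d) => (Φ x : ℂ)) ((2 * Real.pi)⁻¹ • ω)).re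

/-- A radial continuous kernel supported in the closed unit ball whose Fourier transform is
comparable to `(1 + ‖ω‖²)^(-τ)`, with `τ > d / 2`. -/
structure IsKernel {d : ℕ} (Φ : EuclideanSpace ℝ (Fin d) → ℝ) (τ cΦ CΦ : ℝ) : Prop where
  continuous : Continuous Φ
  radial : ∃ φ : ℝ → ℝ, ∀ x, Φ x = φ ‖x‖
  tau_gt : (d : ℝ) / 2 < τ
  cΦ_pos : 0 < cΦ
  CΦ_pos : 0 < CΦ
  lower : ∀ ω, cΦ * (1 + ‖ω‖ ^ 2) ^ (-τ) ≤ fourierHat Φ ω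
  upper : ∀ ω, fourierHat Φ ω ≤ CΦ * (1 + ‖ω‖ ^ 2) ^ (-τ)
  support : tsupport Φ ⊆ Metric.closedBall 0 1

/-- The scaled kernel `Φ_δ(x) = δ^(-d) Φ(x / δ)`. -/
def scaledKernel {d : ℕ} (Φ : EuclideanSpace ℝ (Fin d) → ℝ) (δ : ℝ)
    (x : EuclideanSpace ℝ (Fin d)) : ℝ :=
  (δ ^ d)⁻¹ * Φ (δ⁻¹ • x)

/-! ### Point sets -/

/-- `sup_{y ∈ Ω} min_j ‖y - x_j‖`. -/
def fillDistance {d n : ℕ} (Ω : Set (EuclideanSpace ℝ (Fin d)))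
    (x : Fin n → EuclideanSpace ℝ (Fin d)) : ℝ :=
  ⨆ y : Ω, ⨅ j : Fin n, ‖(y : EuclideanSpace ℝ (Fin d)) - x j‖

/-- `(1/2) min_{j ≠ k} ‖x_j - x_k‖`. -/
def separationDistance {d n : ℕ} (x : Fin n → EuclideanSpace ℝ (Fin d)) : ℝ :=
  2⁻¹ * ⨅ p : {p : Fin n × Fin n // p.1 ≠ p.2}, ‖x p.1.1 - x p.1.2‖

/-- A quasi-uniform sequence of point sets `X_ℓ = {x ℓ 1, …, x ℓ (N ℓ)} ⊆ Ω`, for the levels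
`ℓ = 1, 2, …` (level `0` is not used), together with the scaling factor `ν`
of the kernel widths. -/
structure IsPointSequence {d : ℕ} (Ω : Set (EuclideanSpace ℝ (Fin d))) (N : ℕ → ℕ)
    (x : (ℓ : ℕ) → Fin (N ℓ) → EuclideanSpace ℝ (Fin d)) (μ ch cq ν : ℝ) : Prop where
  isOpen : IsOpen Ω
  nonempty : Ω.Nonempty
  bounded : Bornology.IsBounded Ω
  mem : ∀ ℓ, 1 ≤ ℓ → ∀ j, x ℓ j ∈ Ω
  μ_pos : 0 < μ
  μ_lt : μ < 1
  ch_pos : 0 < ch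
  ch_le : ch ≤ 1
  fill_lower : ∀ ℓ, 1 ≤ ℓ → ch * μ * fillDistance Ω (x ℓ) ≤ fillDistance Ω (x (ℓ + 1))
  fill_upper : ∀ ℓ, 1 ≤ ℓ → fillDistance Ω (x (ℓ + 1)) ≤ μ * fillDistance Ω (x ℓ)
  sep_le_fill : ∀ ℓ, 1 ≤ ℓ → separationDistance (x ℓ) ≤ fillDistance Ω (x ℓ)
  fill_le_sep : ∀ ℓ, 1 ≤ ℓ → fillDistance Ω (x ℓ) ≤ cq * separationDistance (x ℓ)
  card_lower : ∃ c : ℝ, 0 < c ∧ ∀ ℓ, 1 ≤ ℓ → c * (μ ^ (d * ℓ))⁻¹ ≤ (N ℓ : ℝ)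
  ν_lower : 1 / fillDistance Ω (x 1) ≤ ν
  μ_pow : 2 < (μ ^ d)⁻¹

/-! ### Matrices -/

/-- The width `δ_ℓ = ν h_ℓ` of the kernel on level `ℓ`. -/
def width {d : ℕ} (Ω : Set (EuclideanSpace ℝ (Fin d))) {N : ℕ → ℕ}
    (x : (ℓ : ℕ) → Fin (N ℓ) → EuclideanSpace ℝ (Fin d)) (ν : ℝ) (ℓ : ℕ) : ℝ :=
  ν * fillDistance Ω (x ℓ)

/-- `B_{k,ℓ} = (Φ_{δ_ℓ}(x^{(k)}_i - x^{(ℓ)}_j))_{i,j}`. -/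
def matB {d : ℕ} (Φ : EuclideanSpace ℝ (Fin d) → ℝ) (Ω : Set (EuclideanSpace ℝ (Fin d)))
    {N : ℕ → ℕ} (x : (ℓ : ℕ) → Fin (N ℓ) → EuclideanSpace ℝ (Fin d)) (ν : ℝ) (k ℓ : ℕ) :
    Matrix (Fin (N k)) (Fin (N ℓ)) ℝ :=
  Matrix.of fun i j => scaledKernel Φ (width Ω x ν ℓ) (x k i - x ℓ j)

/-- `𝔛_{k,ℓ} = B_{k,ℓ} A_ℓ⁻¹` with `A_ℓ = B_{ℓ,ℓ}`. -/
def matX {d : ℕ} (Φ : EuclideanSpace ℝ (Fin d) → ℝ) (Ω : Set (EuclideanSpace ℝ (Fin d)))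
    {N : ℕ → ℕ} (x : (ℓ : ℕ) → Fin (N ℓ) → EuclideanSpace ℝ (Fin d)) (ν : ℝ) (k ℓ : ℕ) :
    Matrix (Fin (N k)) (Fin (N ℓ)) ℝ :=
  matB Φ Ω x ν k ℓ * (matB Φ Ω x ν ℓ ℓ)⁻¹

/-- The unknowns on the levels `1, …, L`: the block `b : Fin L` belongs to the level `b + 1`. -/
abbrev Idx (N : ℕ → ℕ) (L : ℕ) : Type := Σ b : Fin L, Fin (N ((b : ℕ) + 1))

/-- The point that belongs to an index. -/
def node {d : ℕ} {N : ℕ → ℕ} (x : (ℓ : ℕ) → Fin (N ℓ) → EuclideanSpace ℝ (Fin d)) {L : ℕ}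
    (p : Idx N L) : EuclideanSpace ℝ (Fin d) :=
  x ((p.1 : ℕ) + 1) p.2

/-- The block lower triangular matrix `T'_L`, with identity blocks on the diagonal and the blocks
`𝔛_{k,ℓ}` below the diagonal (`k > ℓ`). -/
def matT {d : ℕ} (Φ : EuclideanSpace ℝ (Fin d) → ℝ) (Ω : Set (EuclideanSpace ℝ (Fin d)))
    {N : ℕ → ℕ} (x : (ℓ : ℕ) → Fin (N ℓ) → EuclideanSpace ℝ (Fin d)) (ν : ℝ) (L : ℕ) :
    Matrix (Idx N L) (Idx N L) ℝ :=
  Matrix.of fun p r =>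
    if r.1 < p.1 then matX Φ Ω x ν ((p.1 : ℕ) + 1) ((r.1 : ℕ) + 1) p.2 r.2
    else if p = r then 1 else 0

/-- The Jacobi matrix `M = id - T'_L`. -/
def matM {d : ℕ} (Φ : EuclideanSpace ℝ (Fin d) → ℝ) (Ω : Set (EuclideanSpace ℝ (Fin d)))
    {N : ℕ → ℕ} (x : (ℓ : ℕ) → Fin (N ℓ) → EuclideanSpace ℝ (Fin d)) (ν : ℝ) (L : ℕ) :
    Matrix (Idx N L) (Idx N L) ℝ :=
  1 - matT Φ Ω x ν L

/-- The thresholded matrix `M̃(T)`: an entry of `M` is kept if the distance of its two points is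
less than `T q_j`, where `j` is the level of its column, and is replaced by `0` otherwise. -/
def matMThreshold {d : ℕ} (Φ : EuclideanSpace ℝ (Fin d) → ℝ)
    (Ω : Set (EuclideanSpace ℝ (Fin d))) {N : ℕ → ℕ}
    (x : (ℓ : ℕ) → Fin (N ℓ) → EuclideanSpace ℝ (Fin d)) (ν : ℝ) (L : ℕ) (T : ℝ) :
    Matrix (Idx N L) (Idx N L) ℝ :=
  open Classical in
  Matrix.of fun p r =>
    if ‖node x p - node x r‖ < T * separationDistance (x ((r.1 : ℕ) + 1)) then
      matM Φ Ω x ν L p r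
    else 0

/-- The right-hand side `(f|_{X_1}, …, f|_{X_L})`. -/
def rhs {d : ℕ} {N : ℕ → ℕ} (x : (ℓ : ℕ) → Fin (N ℓ) → EuclideanSpace ℝ (Fin d)) (L : ℕ)
    (f : EuclideanSpace ℝ (Fin d) → ℝ) : Idx N L → ℝ :=
  fun p => f (node x p)

/-- The Jacobi iteration `β_{m+1} = y + M β_m` with starting vector `β₀`. -/
def jacobi {ι : Type} [Fintype ι] (M : Matrix ι ι ℝ) (y β₀ : ι → ℝ) : ℕ → ι → ℝ
  | 0 => β₀
  | m + 1 => y + M *ᵥ jacobi M y β₀ m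

/-! ### Constants -/

/-- `M_d = 12 (π Γ(d/2+1)² / 9)^(1/(d+1))`. -/
def constM (d : ℕ) : ℝ :=
  12 * (Real.pi * Real.Gamma ((d : ℝ) / 2 + 1) ^ 2 / 9) ^ (1 / ((d : ℝ) + 1))

/-- `C_d = (M_d / 2^(3/2))^d / (2 Γ(d/2+1))`. -/
def constCd (d : ℕ) : ℝ :=
  1 / (2 * Real.Gamma ((d : ℝ) / 2 + 1)) * (constM d / (2 : ℝ) ^ ((3 : ℝ) / 2)) ^ d

/-- `Φ(0) (C_d c_Φ)⁻¹ (1 + 4 M_d² ν² c_q²)^τ`, where `Φ0` stands for `Φ(0)`. -/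
def constK (d : ℕ) (τ cΦ Φ0 cq ν : ℝ) : ℝ :=
  Φ0 * (constCd d * cΦ)⁻¹ * (1 + 4 * constM d ^ 2 * ν ^ 2 * cq ^ 2) ^ τ

/-- `z = 4^d Φ(0) (C_d c_Φ)⁻¹ (1 + 4 M_d² ν² c_q²)^τ`, the bound of the condition numbers. -/
def constZ (d : ℕ) (τ cΦ Φ0 cq ν : ℝ) : ℝ :=
  4 ^ d * constK d τ cΦ Φ0 cq ν

/-- `θ = -(1/(2R)) log((√z - 1) / (√z + 1))` with `R = √d max(c_q ν, 4)`. -/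
def constTheta (d : ℕ) (τ cΦ Φ0 cq ν : ℝ) : ℝ :=
  -(1 / (2 * (√(d : ℝ) * max (cq * ν) 4))) *
    Real.log ((√(constZ d τ cΦ Φ0 cq ν) - 1) / (√(constZ d τ cΦ Φ0 cq ν) + 1))

/-- `C = 2 Φ(0) (C_d c_Φ)⁻¹ (1 + 4 M_d² ν² c_q²)^τ e^(2θ√d) e^(c_q ν θ) (1 + ν c_q)^d`. -/
def constC (d : ℕ) (τ cΦ Φ0 cq ν : ℝ) : ℝ :=
  2 * constK d τ cΦ Φ0 cq ν * Real.exp (2 * constTheta d τ cΦ Φ0 cq ν * √(d : ℝ)) *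
    Real.exp (cq * ν * constTheta d τ cΦ Φ0 cq ν) * (1 + ν * cq) ^ d

/-- `C_Σ = ∑_{m ≥ 0} (m+2)^d e^(-θ m)`. -/
def constSigma (d : ℕ) (τ cΦ Φ0 cq ν : ℝ) : ℝ :=
  ∑' m : ℕ, ((m : ℝ) + 2) ^ d * Real.exp (-constTheta d τ cΦ Φ0 cq ν * m)

end Multiscale

end

namespace Multiscale

/-! ### Estimates for the constants -/

/-! `M` is strictly block lower triangular, and so is its thresholded version. After `L` steps of
either iteration the starting vector is forgotten (`jacobi_matM_eq`, `jacobi_matMThreshold_eq`), and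
the solution of each linear system is a fixed point of its iteration. Both claims therefore reduce
to comparing two iterations started at zero.

With `S = C * C_Σ`, every row sum of `|M|` and of `|M̃|` is at most `L S`, and every row sum of `|M
- M̃|` is at most `L S e^θ e^(-θT/2)`. An induction (`abs_jacobi_sub_jacobi_le`) bounds the error
after `L` steps in the maximum norm by `e^θ e^(-θT/2) L² (L S)^(L-1)` times the bound of `f`. The
Euclidean norm costs the square root of the number of unknowns, which packing bounds by `N 1` times
a power of `1 / (ch μ)` (`card_idx_le`). The largeness of `L`, raised to the power `2 L`, absorbs
the remaining factors (`sqrt_mul_le_inv_pow`).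

The row sums come from the exponential decay of the rows of `B A⁻¹`. Compact support makes `A`
banded, so polynomials in `A` of low degree vanish far from the diagonal. Chebyshev polynomials
approximate `A⁻¹` at a rate governed by the condition number (`abs_inv_apply_le`), and packing in
shells sums the exponentials.

The condition number is bounded by `z`. The largest eigenvalue is controlled by absolute row sums,
the smallest by an Ingham type inequality (`le_sum_sum_mul_cosTransform`): a minorant of the Fourier
transform of `Φ` is built whose own transform vanishes at all differences of distinct points, so
that only the diagonal survives. The elementary bounds on `Γ` and `M_d` show that the resulting
constant is no worse than `C_d`. If `δ ≤ 2 q`, then `A` is a multiple of the identity, and the same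
row sums follow from the lower bound `2 ^ d ≤ K C_Σ`. -/

theorem two_step_induction {P : ℕ → Prop} (h1 : P 1) (h2 : P 2)
    (h : ∀ d, 1 ≤ d → P d → P (d + 2)) : ∀ d, 1 ≤ d → P d
  | 0, h0 => absurd h0 (by norm_num)
  | 1, _ => h1
  | 2, _ => h2
  | d + 3, _ => h (d + 1) (by omega) (two_step_induction h1 h2 h (d + 1) (by omega))

theorem Gamma_half_one_sq : Real.Gamma (((1 : ℕ) : ℝ) / 2 + 1) ^ 2 = Real.pi / 4 := by
  rw [Real.Gamma_add_one (by norm_num)]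
  have : Real.Gamma (((1 : ℕ) : ℝ) / 2) = √Real.pi := by
    rw [← Real.Gamma_one_half_eq]; norm_num
  rw [this, mul_pow, Real.sq_sqrt Real.pi_pos.le]
  norm_num; ring

theorem Gamma_half_two_sq : Real.Gamma (((2 : ℕ) : ℝ) / 2 + 1) ^ 2 = 1 := by
  have : (((2 : ℕ) : ℝ) / 2 + 1) = 2 := by norm_num
  rw [this, Real.Gamma_two, one_pow]

theorem Gamma_half_add_two_sq (d : ℕ) :
    Real.Gamma (((d + 2 : ℕ) : ℝ) / 2 + 1) ^ 2 =
      (((d : ℝ) + 2) / 2) ^ 2 * Real.Gamma ((d : ℝ) / 2 + 1) ^ 2 := by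
  have h : (((d + 2 : ℕ) : ℝ) / 2 + 1) = ((d : ℝ) / 2 + 1) + 1 := by push_cast; ring
  rw [h, Real.Gamma_add_one (by positivity), mul_pow]
  congr 2; ring

theorem Gamma_half_pos (d : ℕ) : 0 < Real.Gamma ((d : ℝ) / 2 + 1) :=
  Real.Gamma_pos_of_pos (by positivity)

theorem pi_div_four_le_Gamma_sq {d : ℕ} (hd : 1 ≤ d) :
    Real.pi / 4 ≤ Real.Gamma ((d : ℝ) / 2 + 1) ^ 2 := by
  refine two_step_induction (P := fun d : ℕ => Real.pi / 4 ≤ Real.Gamma ((d : ℝ) / 2 + 1) ^ 2)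
    Gamma_half_one_sq.ge ?_ ?_ d hd
  · rw [Gamma_half_two_sq]; linarith [Real.pi_lt_four]
  · intro d hd h
    rw [Gamma_half_add_two_sq]
    have h1 : (1 : ℝ) ≤ (((d : ℝ) + 2) / 2) ^ 2 := by
      have : (0 : ℝ) ≤ d := by positivity
      nlinarith
    nlinarith [sq_nonneg (Real.Gamma ((d : ℝ) / 2 + 1))]

/-- There is equality at `d = 1`. In the induction step the functional equation supplies exactly the
two additional powers of `(d + 2) / 2`. -/
theorem Gamma_sq_le {d : ℕ} (hd : 1 ≤ d) :
    Real.Gamma ((d : ℝ) / 2 + 1) ^ 2 ≤ Real.pi / 2 * ((d : ℝ) / 2) ^ d := by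
  refine two_step_induction
    (P := fun d : ℕ => Real.Gamma ((d : ℝ) / 2 + 1) ^ 2 ≤ Real.pi / 2 * ((d : ℝ) / 2) ^ d)
    ?_ ?_ ?_ d hd
  · rw [Gamma_half_one_sq]; norm_num; linarith
  · rw [Gamma_half_two_sq]; norm_num; linarith [Real.pi_gt_three]
  · intro d hd h
    rw [Gamma_half_add_two_sq]
    have h1 : ((d : ℝ) / 2) ^ d ≤ (((d + 2 : ℕ) : ℝ) / 2) ^ d := by
      gcongr; linarith
    calc (((d : ℝ) + 2) / 2) ^ 2 * Real.Gamma ((d : ℝ) / 2 + 1) ^ 2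
        ≤ (((d : ℝ) + 2) / 2) ^ 2 * (Real.pi / 2 * (((d + 2 : ℕ) : ℝ) / 2) ^ d) := by
          gcongr
          exact h.trans (by gcongr)
      _ = _ := by push_cast; ring

/-- The constant 25 is what the induction for `pow_le_pi_mul_Gamma_sq` can afford, since `((d + 2) /
2) ^ 2 = 25 * ((d + 2) / 10) ^ 2`. -/
theorem one_add_two_div_pow_le {d : ℕ} (hd : 1 ≤ d) : (1 + 2 / (d : ℝ)) ^ (d + 1) ≤ 25 := by
  rcases hd.eq_or_lt with rfl | hd
  · norm_num
  · have hd' : (2 : ℝ) ≤ d := by exact_mod_cast hd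
    calc (1 + 2 / (d : ℝ)) ^ (d + 1) ≤ Real.exp (2 / d) ^ (d + 1) := by
          gcongr; linarith [Real.add_one_le_exp (2 / (d : ℝ))]
      _ = Real.exp ((d + 1 : ℕ) * (2 / (d : ℝ))) := (Real.exp_nat_mul _ _).symm
      _ ≤ Real.exp 3 := by
          gcongr
          rw [mul_div_assoc', div_le_iff₀ (by linarith)]
          push_cast; linarith
      _ = Real.exp 1 ^ 3 := by rw [← Real.exp_nat_mul]; norm_num
      _ ≤ (2.72 : ℝ) ^ 3 := by
          gcongr; linarith [Real.exp_one_lt_d9]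
      _ ≤ 25 := by norm_num

theorem pow_le_pi_mul_Gamma_sq {d : ℕ} (hd : 1 ≤ d) :
    ((d : ℝ) / 10) ^ (d + 1) ≤ Real.pi * Real.Gamma ((d : ℝ) / 2 + 1) ^ 2 / 9 := by
  refine two_step_induction
    (P := fun d : ℕ => ((d : ℝ) / 10) ^ (d + 1) ≤ Real.pi * Real.Gamma ((d : ℝ) / 2 + 1) ^ 2 / 9)
    ?_ ?_ ?_ d hd
  · rw [Gamma_half_one_sq]; norm_num; nlinarith [Real.pi_gt_three]
  · rw [Gamma_half_two_sq]; norm_num; linarith [Real.pi_gt_three]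
  · intro d hd h
    have hd0 : (0 : ℝ) < d := by exact_mod_cast hd
    rw [Gamma_half_add_two_sq]
    have h1 : (((d + 2 : ℕ) : ℝ) / 10) ^ (d + 2 + 1) =
        ((d : ℝ) / 10) ^ (d + 1) * ((1 + 2 / (d : ℝ)) ^ (d + 1) * (((d : ℝ) + 2) / 10) ^ 2) := by
      have : ((d + 2 : ℕ) : ℝ) / 10 = (d : ℝ) / 10 * (1 + 2 / (d : ℝ)) := by
        push_cast; field_simp
      rw [show d + 2 + 1 = (d + 1) + 2 by ring, pow_add, this, mul_pow, mul_assoc, ← this]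
      push_cast; rfl
    rw [h1]
    calc ((d : ℝ) / 10) ^ (d + 1) * ((1 + 2 / (d : ℝ)) ^ (d + 1) * (((d : ℝ) + 2) / 10) ^ 2)
        ≤ (Real.pi * Real.Gamma ((d : ℝ) / 2 + 1) ^ 2 / 9) * (25 * (((d : ℝ) + 2) / 10) ^ 2) := by
          gcongr
          exact one_add_two_div_pow_le hd
      _ = _ := by ring

theorem constM_pow (d : ℕ) :
    constM d ^ (d + 1) = 12 ^ (d + 1) * (Real.pi * Real.Gamma ((d : ℝ) / 2 + 1) ^ 2 / 9) := by
  have h0 : 0 ≤ Real.pi * Real.Gamma ((d : ℝ) / 2 + 1) ^ 2 / 9 := by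
    have := Real.pi_pos; positivity
  rw [constM, mul_pow, ← Real.rpow_natCast _ (d + 1), ← Real.rpow_natCast (_ ^ _) (d + 1),
    ← Real.rpow_mul h0]
  have : (1 / ((d : ℝ) + 1)) * ((d + 1 : ℕ) : ℝ) = 1 := by push_cast; field_simp
  rw [this, Real.rpow_one, Real.rpow_natCast]

theorem constM_pos (d : ℕ) : 0 < constM d := by
  have := Real.pi_pos
  have := Gamma_half_pos d
  unfold constM; positivity

/-- On taking `(d + 1)`-th powers this becomes `(π / 6) ^ (d + 1) ≤ π Γ² / 9`. As `π / 6 < 1`, the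
exponent may be lowered to 2, and `π / 4 ≤ Γ²` then suffices. -/
theorem two_pi_le_constM {d : ℕ} (hd : 1 ≤ d) : 2 * Real.pi ≤ constM d := by
  have hpi := Real.pi_pos
  refine le_of_pow_le_pow_left₀ (Nat.succ_ne_zero d) (constM_pos d).le ?_
  rw [Nat.succ_eq_add_one, constM_pow]
  have h : 2 * Real.pi = 12 * (Real.pi / 6) := by ring
  rw [h, mul_pow]
  gcongr
  calc (Real.pi / 6) ^ (d + 1) ≤ (Real.pi / 6) ^ 2 := by
        apply pow_le_pow_of_le_one (by positivity) _ (by omega)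
        linarith [Real.pi_lt_four]
    _ ≤ Real.pi * Real.Gamma ((d : ℝ) / 2 + 1) ^ 2 / 9 := by
        nlinarith [pi_div_four_le_Gamma_sq hd]

theorem mul_le_constM {d : ℕ} (hd : 1 ≤ d) : 6 / 5 * (d : ℝ) ≤ constM d := by
  refine le_of_pow_le_pow_left₀ (Nat.succ_ne_zero d) (constM_pos d).le ?_
  rw [Nat.succ_eq_add_one, constM_pow]
  have h : 6 / 5 * (d : ℝ) = 12 * (d / 10) := by ring
  rw [h, mul_pow]
  gcongr
  exact pow_le_pi_mul_Gamma_sq hd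

theorem two_rpow_three_half : (2 : ℝ) ^ ((3 : ℝ) / 2) = 2 * √2 := by
  rw [show (3 : ℝ) / 2 = 1 + 1 / 2 by norm_num, Real.rpow_add (by norm_num), Real.rpow_one,
    Real.sqrt_eq_rpow]

theorem constCd_pos (d : ℕ) : 0 < constCd d := by
  have := Gamma_half_pos d
  have := constM_pos d
  unfold constCd; positivity

/-- A form of `C_d` without the power `M_d ^ d`. -/
theorem constCd_eq (d : ℕ) :
    constCd d = 2 * Real.pi / (3 * constM d) * Real.Gamma ((d : ℝ) / 2 + 1) * (3 * √2) ^ d := by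
  have hG := Gamma_half_pos d
  have hM := constM_pos d
  have h2 : (0 : ℝ) < √2 := by positivity
  have h : constM d ^ d = 12 ^ (d + 1) * (Real.pi * Real.Gamma ((d : ℝ) / 2 + 1) ^ 2 / 9) /
      constM d := by
    rw [← constM_pow, pow_succ]; field_simp
  have e : (3 * √2) ^ d = 12 ^ d / (2 * √2) ^ d := by
    rw [← div_pow]; congr 1
    field_simp
    nlinarith [Real.sq_sqrt (show (0 : ℝ) ≤ 2 by norm_num)]
  rw [constCd, two_rpow_three_half, div_pow, h, e]
  field_simp
  ring

/-- The constant obtained from the triangle minorant dominates `C_d / 2 ^ d`. -/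
theorem constCd_le {d : ℕ} (hd : 1 ≤ d) :
    constCd d * (1 / 2) ^ d ≤ (√(2 * Real.pi)) ^ d * (2 * √(d : ℝ) / 3) ^ d *
      (1 - 3 * (d : ℝ) ^ 2 / (4 * constM d ^ 2)) := by
  have hG := Gamma_half_pos d
  have hM := constM_pos d
  have hpi := Real.pi_pos
  have hd0 : (0 : ℝ) < d := by exact_mod_cast hd
  have hM1 := two_pi_le_constM hd
  have hM2 := mul_le_constM hd
  -- The factor 1.255 is a rational upper bound of `√(π / 2)`.
  have hGle : Real.Gamma ((d : ℝ) / 2 + 1) ≤ 5 / 4 * (1 + 1 / 250) * (√((d : ℝ) / 2)) ^ d := by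
    refine le_of_sq_le_sq ?_ (by positivity)
    rw [mul_pow, ← pow_mul, mul_comm d 2, pow_mul, Real.sq_sqrt (by positivity)]
    refine (Gamma_sq_le hd).trans ?_
    gcongr
    linarith [Real.pi_lt_d2]
  -- From `M_d ≥ 6 d / 5` the subtracted quotient is at most `75 / 144`.
  have hlast : (12 / 25 : ℝ) - 1 / 1000 ≤ 1 - 3 * (d : ℝ) ^ 2 / (4 * constM d ^ 2) := by
    have : 3 * (d : ℝ) ^ 2 / (4 * constM d ^ 2) ≤ 75 / 144 := by
      rw [div_le_div_iff₀ (by positivity) (by norm_num)]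
      nlinarith
    linarith
  have hs : (5 / 2 : ℝ) ≤ √(2 * Real.pi) := by
    apply Real.le_sqrt_of_sq_le; nlinarith [Real.pi_gt_d2]
  rw [constCd_eq]
  have h1 : 2 * Real.pi / (3 * constM d) ≤ 1 / 3 := by
    rw [div_le_div_iff₀ (by positivity) (by norm_num)]; linarith
  have e : (3 * √2) * (1 / 2) * √((d : ℝ) / 2) = 3 / 2 * √(d : ℝ) := by
    rw [Real.sqrt_div hd0.le]
    have : (0 : ℝ) < √2 := by positivity
    field_simp
  calc 2 * Real.pi / (3 * constM d) * Real.Gamma ((d : ℝ) / 2 + 1) * (3 * √2) ^ d * (1 / 2) ^ d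
      ≤ 1 / 3 * (5 / 4 * (1 + 1 / 250) * (√((d : ℝ) / 2)) ^ d) * (3 * √2) ^ d * (1 / 2) ^ d := by
        gcongr
    _ = 1 / 3 * (5 / 4 * (1 + 1 / 250)) * ((3 * √2) * (1 / 2) * √((d : ℝ) / 2)) ^ d := by
        have h3 : ∀ a b c : ℝ, (a * b * c) ^ d = a ^ d * b ^ d * c ^ d := fun a b c => by
          rw [mul_pow, mul_pow]
        rw [h3 (3 * √2)]; ring
    _ = 1 / 3 * (5 / 4 * (1 + 1 / 250)) * (3 / 2 * √(d : ℝ)) ^ d := by rw [e]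
    _ ≤ (12 / 25 - 1 / 1000) * (√(2 * Real.pi) * (2 * √(d : ℝ) / 3)) ^ d := by
        gcongr ?_ * ?_ ^ d
        · norm_num
        · nlinarith [Real.sqrt_nonneg (d : ℝ)]
    _ = (√(2 * Real.pi)) ^ d * (2 * √(d : ℝ) / 3) ^ d * (12 / 25 - 1 / 1000) := by
        rw [mul_pow]; ring
    _ ≤ _ := by gcongr

/-- The lower bound for `K` that results from `Φ̂(0) ≤ (2π)^(-d/2) vol(B_1) Φ(0)`. -/
theorem three_mul_le_div_constCd {d : ℕ} (hd : 1 ≤ d) :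
    3 * (1 / 3) ^ d ≤ (√2) ^ d * Real.Gamma ((d : ℝ) / 2 + 1) / constCd d := by
  have hG := Gamma_half_pos d
  have hpi := Real.pi_pos
  have hM1 := two_pi_le_constM hd
  have hM := constM_pos d
  rw [le_div_iff₀ (constCd_pos d), constCd_eq]
  have h1 : 3 * (2 * Real.pi / (3 * constM d)) ≤ 1 := by
    rw [mul_div_assoc', div_le_one (by positivity)]; nlinarith
  calc _ = (3 * (2 * Real.pi / (3 * constM d))) * ((√2) ^ d * Real.Gamma ((d : ℝ) / 2 + 1)) *
        ((1 / 3) ^ d * 3 ^ d) := by rw [mul_pow]; ring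
    _ = (3 * (2 * Real.pi / (3 * constM d))) * ((√2) ^ d * Real.Gamma ((d : ℝ) / 2 + 1)) := by
        rw [← mul_pow]; norm_num
    _ ≤ 1 * ((√2) ^ d * Real.Gamma ((d : ℝ) / 2 + 1)) := by gcongr
    _ = _ := one_mul _

end Multiscale

namespace Multiscale

/-! ### Packing -/

/-- The balls of radius `q` around the points are disjoint and lie in a ball of radius `r + q`;
compare volumes. -/
theorem card_le_of_separated {d : ℕ} {ι : Type*} (s : Finset ι)
    (x : ι → EuclideanSpace ℝ (Fin d)) (y : EuclideanSpace ℝ (Fin d)) {q r : ℝ} (hq : 0 < q)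
    (hr : 0 ≤ r) (hsep : ∀ i ∈ s, ∀ j ∈ s, i ≠ j → 2 * q ≤ ‖x i - x j‖)
    (hball : ∀ i ∈ s, ‖x i - y‖ ≤ r) : (s.card : ℝ) ≤ (1 + r / q) ^ d := by
  have hfin : Module.finrank ℝ (EuclideanSpace ℝ (Fin d)) = d := finrank_euclideanSpace_fin
  have hdisj : (s : Set ι).PairwiseDisjoint fun i => Metric.ball (x i) q := by
    intro i hi j hj hij
    apply Metric.ball_disjoint_ball
    rw [dist_eq_norm]
    linarith [hsep i hi j hj hij]
  have hsub : (⋃ i ∈ s, Metric.ball (x i) q) ⊆ Metric.ball y (r + q) := by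
    intro z hz
    simp only [Set.mem_iUnion, Metric.mem_ball, dist_eq_norm] at hz ⊢
    obtain ⟨i, hi, hz⟩ := hz
    calc ‖z - y‖ = ‖(z - x i) + (x i - y)‖ := by congr 1; abel
      _ ≤ ‖z - x i‖ + ‖x i - y‖ := norm_add_le _ _
      _ < r + q := by linarith [hball i hi]
  have hvol : ∀ (z : EuclideanSpace ℝ (Fin d)) {ρ : ℝ}, 0 < ρ →
      volume.real (Metric.ball z ρ) =
        ρ ^ d * volume.real (Metric.ball (0 : EuclideanSpace ℝ (Fin d)) 1) := by
    intro z ρ hρ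
    rw [measureReal_def, Measure.addHaar_ball_of_pos _ _ hρ, hfin, ENNReal.toReal_mul,
      ENNReal.toReal_ofReal (by positivity), measureReal_def]
  have h1 : volume.real (⋃ i ∈ s, Metric.ball (x i) q) =
      s.card * (q ^ d * volume.real (Metric.ball (0 : EuclideanSpace ℝ (Fin d)) 1)) := by
    rw [measureReal_biUnion_finset hdisj (fun i _ => measurableSet_ball)
      (fun i _ => measure_ball_lt_top.ne)]
    simp [hvol _ hq]
  have h2 := measureReal_mono (μ := volume) hsub measure_ball_lt_top.ne
  rw [h1, hvol y (show 0 < r + q by positivity)] at h2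
  have hV : 0 < volume.real (Metric.ball (0 : EuclideanSpace ℝ (Fin d)) 1) :=
    ENNReal.toReal_pos (Metric.measure_ball_pos _ _ one_pos).ne' measure_ball_lt_top.ne
  rw [← mul_assoc] at h2
  have h3 := le_of_mul_le_mul_right h2 hV
  have h4 : 1 + r / q = (r + q) / q := by field_simp; ring
  rw [h4, div_pow, le_div_iff₀ (by positivity)]
  exact h3

end Multiscale

namespace Multiscale

/-! ### The cosine transform -/

section CosTransform

variable {V : Type*} [NormedAddCommGroup V] [InnerProductSpace ℝ V] [MeasurableSpace V]
  [BorelSpace V]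

theorem integrable_mul_cos_inner [SecondCountableTopology V] {μ : Measure V}
    {f : V → ℝ} (hf : Integrable f μ) (x : V) :
    Integrable (fun v => f v * Real.cos (2 * Real.pi * inner ℝ v x)) μ :=
  hf.mul_bdd (c := 1) (Continuous.aestronglyMeasurable (by fun_prop))
    (Filter.Eventually.of_forall fun t => by simpa using Real.abs_cos_le_one _)

variable [FiniteDimensional ℝ V]

/-- The cosine transform, which is the Fourier transform of an even function. -/
noncomputable def cosTransform (f : V → ℝ) (ξ : V) : ℝ :=
  ∫ v, f v * Real.cos (2 * Real.pi * inner ℝ v ξ)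

/-- The sine part is the integral of an odd function. -/
theorem fourier_ofReal_even {f : V → ℝ} (hf : Integrable f) (heven : ∀ t, f (-t) = f t) (ξ : V) :
    𝓕 (fun t : V => (f t : ℂ)) ξ = (cosTransform f ξ : ℂ) := by
  have hc := integrable_mul_cos_inner hf ξ
  have hs : Integrable fun t => f t * Real.sin (2 * Real.pi * inner ℝ t ξ) :=
    hf.mul_bdd (c := 1)
      (Continuous.aestronglyMeasurable (by fun_prop))
      (Filter.Eventually.of_forall fun t => by simpa using Real.abs_sin_le_one _)
  have h0 : ∫ t, f t * Real.sin (2 * Real.pi * inner ℝ t ξ) = 0 := by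
    have h := integral_neg_eq_self (fun t => f t * Real.sin (2 * Real.pi * inner ℝ t ξ)) volume
    have h' : (∫ t, f (-t) * Real.sin (2 * Real.pi * inner ℝ (-t) ξ)) =
        -∫ t, f t * Real.sin (2 * Real.pi * inner ℝ t ξ) := by
      rw [← integral_neg]
      congr 1; ext t
      rw [heven, inner_neg_left, mul_neg, Real.sin_neg, mul_neg]
    linarith
  rw [Real.fourier_eq']
  have h : ∀ t : V, Complex.exp (((-2 * Real.pi * inner ℝ t ξ : ℝ) : ℂ) * Complex.I) • (f t : ℂ) =
      ((f t * Real.cos (2 * Real.pi * inner ℝ t ξ) : ℝ) : ℂ) -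
        ((f t * Real.sin (2 * Real.pi * inner ℝ t ξ) : ℝ) : ℂ) * Complex.I := by
    intro t
    rw [show (-2 * Real.pi * inner ℝ t ξ : ℝ) = -(2 * Real.pi * inner ℝ t ξ) by ring,
      Complex.exp_mul_I, ← Complex.ofReal_cos, ← Complex.ofReal_sin, Real.cos_neg, Real.sin_neg]
    push_cast
    rw [smul_eq_mul]
    ring
  simp_rw [h]
  rw [integral_sub hc.ofReal (hs.ofReal.mul_const _), integral_mul_const, integral_complex_ofReal,
    integral_complex_ofReal, h0]
  simp [cosTransform]

theorem continuous_cosTransform {f : V → ℝ} (hf : Integrable f) (heven : ∀ t, f (-t) = f t) :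
    Continuous (cosTransform f) := by
  have h : Continuous (𝓕 (fun t : V => (f t : ℂ))) :=
    VectorFourier.fourierIntegral_continuous Real.continuous_fourierChar
      (innerSL ℝ).continuous₂ hf.ofReal
  have h' : cosTransform f = fun ξ => (𝓕 (fun t : V => (f t : ℂ)) ξ).re := by
    ext ξ; rw [fourier_ofReal_even hf heven, Complex.ofReal_re]
  rw [h']
  exact Complex.continuous_re.comp h

theorem cosTransform_neg (f : V → ℝ) (ξ : V) : cosTransform f (-ξ) = cosTransform f ξ := by
  unfold cosTransform
  congr 1; ext t
  rw [inner_neg_right, mul_neg, Real.cos_neg]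

/-- This is Fourier inversion: on even functions the forward and inverse transforms agree. -/
theorem cosTransform_cosTransform {f : V → ℝ} (hc : Continuous f) (hf : Integrable f)
    (heven : ∀ t, f (-t) = f t) (hF : Integrable (cosTransform f)) (v : V) :
    cosTransform (cosTransform f) v = f v := by
  have hF' : 𝓕 (fun t : V => (f t : ℂ)) = fun ξ => (cosTransform f ξ : ℂ) := by
    ext ξ; exact fourier_ofReal_even hf heven ξ
  have h := hf.ofReal (𝕜 := ℂ) |>.fourierInv_fourier_eq (v := v)
    (by
      change Integrable (𝓕 (fun t : V => (f t : ℂ)))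
      exact hF' ▸ hF.ofReal)
    (Complex.continuous_ofReal.comp hc).continuousAt
  have h3 : 𝓕⁻ (fun ξ : V => (cosTransform f ξ : ℂ)) v = (f v : ℂ) := hF' ▸ h
  rw [Real.fourierInv_eq_fourier_neg, fourier_ofReal_even hF (cosTransform_neg f),
    cosTransform_neg] at h3
  exact_mod_cast h3

end CosTransform

/-! ### The triangle function and its Fourier transform -/

/-- The triangle function of height and half-width `s`. -/
noncomputable def tri (s t : ℝ) : ℝ := max 0 (s - |t|)

/-- The Fourier transform of the triangle function. -/
noncomputable def triHat (s ξ : ℝ) : ℝ := ∫ t, tri s t * Real.cos (2 * Real.pi * t * ξ)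

theorem tri_nonneg (s t : ℝ) : 0 ≤ tri s t := le_max_left _ _

theorem tri_neg (s t : ℝ) : tri s (-t) = tri s t := by simp [tri]

theorem tri_eq_zero {s t : ℝ} (h : s ≤ |t|) : tri s t = 0 := max_eq_left (by linarith)

theorem tri_zero {s : ℝ} (hs : 0 ≤ s) : tri s 0 = s := by simp [tri, hs]

theorem continuous_tri (s : ℝ) : Continuous (tri s) := by unfold tri; fun_prop

theorem hasCompactSupport_tri (s : ℝ) : HasCompactSupport (tri s) := by
  refine HasCompactSupport.intro (isCompact_closedBall (0 : ℝ) s) fun t ht => tri_eq_zero ?_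
  rw [Metric.mem_closedBall, dist_zero_right, Real.norm_eq_abs, not_le] at ht
  exact ht.le

theorem integrable_tri (s : ℝ) : Integrable (tri s) :=
  (continuous_tri s).integrable_of_hasCompactSupport (hasCompactSupport_tri s)

theorem integral_even_eq {s : ℝ} (hs : 0 ≤ s) {f : ℝ → ℝ} (hf : ∀ t, s < t → f t = 0) :
    ∫ t, f |t| = 2 * ∫ t in (0 : ℝ)..s, f t := by
  rw [integral_comp_abs, intervalIntegral.integral_of_le hs]
  congr 1
  refine (setIntegral_eq_of_subset_of_forall_sdiff_eq_zero measurableSet_Ioi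
    (fun t ht => ht.1) fun t ht => hf t ?_)
  by_contra h
  exact ht.2 ⟨ht.1, not_lt.mp h⟩

theorem integral_tri {s : ℝ} (hs : 0 ≤ s) : ∫ t, tri s t = s ^ 2 := by
  have h := integral_even_eq hs (f := fun t => max 0 (s - t)) fun t ht =>
    max_eq_left (by linarith)
  have h2 : ∫ t in (0 : ℝ)..s, max 0 (s - t) = ∫ t in (0 : ℝ)..s, (s - t) := by
    refine intervalIntegral.integral_congr fun t ht => ?_
    rw [Set.uIcc_of_le hs] at ht
    exact max_eq_right (by linarith [ht.2])
  rw [show (∫ t, tri s t) = ∫ t, max 0 (s - |t|) from rfl, h, h2,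
    intervalIntegral.integral_sub (by simp) (by simp)]
  simp; ring

theorem integral_tri_sq {s : ℝ} (hs : 0 ≤ s) : ∫ t, tri s t * tri s t = 2 * s ^ 3 / 3 := by
  have h := integral_even_eq hs (f := fun t => max 0 (s - t) * max 0 (s - t)) fun t ht => by
    simp [max_eq_left (show s - t ≤ 0 by linarith)]
  have h2 : ∫ t in (0 : ℝ)..s, max 0 (s - t) * max 0 (s - t) = ∫ t in (0 : ℝ)..s, (s - t) ^ 2 := by
    refine intervalIntegral.integral_congr fun t ht => ?_
    rw [Set.uIcc_of_le hs] at ht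
    rw [max_eq_right (by linarith [ht.2]), sq]
  rw [show (∫ t, tri s t * tri s t) = ∫ t, max 0 (s - |t|) * max 0 (s - |t|) from rfl, h, h2,
    intervalIntegral.integral_comp_sub_left (fun t => t ^ 2) s]
  simp; ring

/-- An explicit antiderivative gives `1 - cos`, hence `sin²`. The form without division includes `ξ
= 0`. -/
theorem sq_mul_triHat {s : ℝ} (hs : 0 ≤ s) (ξ : ℝ) :
    (Real.pi * ξ) ^ 2 * triHat s ξ = Real.sin (Real.pi * s * ξ) ^ 2 := by
  rcases eq_or_ne ξ 0 with rfl | hξ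
  · simp
  set a := 2 * Real.pi * ξ with ha
  have ha0 : a ≠ 0 := by have := Real.pi_ne_zero; positivity
  have h := integral_even_eq hs (f := fun t => max 0 (s - t) * Real.cos (a * t)) fun t ht => by
    simp [max_eq_left (show s - t ≤ 0 by linarith)]
  have h1 : triHat s ξ = ∫ t, max 0 (s - |t|) * Real.cos (a * |t|) := by
    refine integral_congr_ae (Filter.Eventually.of_forall fun t => ?_)
    have : Real.cos (a * |t|) = Real.cos (2 * Real.pi * t * ξ) := by
      rcases abs_cases t with ⟨h, _⟩ | ⟨h, _⟩ <;> rw [h, ha]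
      · ring_nf
      · rw [← Real.cos_neg]; ring_nf
    simp only [tri, this]
  have h2 : ∫ t in (0 : ℝ)..s, max 0 (s - t) * Real.cos (a * t) =
      ∫ t in (0 : ℝ)..s, (s - t) * Real.cos (a * t) := by
    refine intervalIntegral.integral_congr fun t ht => ?_
    rw [Set.uIcc_of_le hs] at ht
    rw [max_eq_right (by linarith [ht.2])]
  have h3 : ∫ t in (0 : ℝ)..s, (s - t) * Real.cos (a * t) =
      ((s - s) * Real.sin (a * s) / a - Real.cos (a * s) / a ^ 2) -
        ((s - 0) * Real.sin (a * 0) / a - Real.cos (a * 0) / a ^ 2) := by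
    refine intervalIntegral.integral_eq_sub_of_hasDerivAt
      (f := fun t => (s - t) * Real.sin (a * t) / a - Real.cos (a * t) / a ^ 2) (fun t _ => ?_)
      (Continuous.intervalIntegrable (by fun_prop) _ _)
    have e1 : HasDerivAt (fun t => a * t) a t := by simpa using (hasDerivAt_id t).const_mul a
    have e2 := (((hasDerivAt_id t).const_sub s).mul e1.sin).div_const a
    have e3 := e1.cos.div_const (a ^ 2)
    refine (e2.sub e3).congr_deriv ?_
    simp only [id]
    field_simp
    ring
  have h4 : Real.cos (a * s) = 1 - 2 * Real.sin (Real.pi * s * ξ) ^ 2 := by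
    rw [show a * s = 2 * (Real.pi * s * ξ) by rw [ha]; ring, Real.cos_two_mul, Real.cos_sq']
    ring
  rw [h1, h, h2, h3, h4]
  simp only [sub_self, zero_mul, mul_zero, Real.sin_zero, Real.cos_zero, zero_div]
  rw [ha]
  have := Real.pi_ne_zero
  field_simp
  ring

theorem abs_triHat_le {s : ℝ} (hs : 0 ≤ s) (ξ : ℝ) : |triHat s ξ| ≤ s ^ 2 := by
  rw [← integral_tri hs, ← Real.norm_eq_abs]
  refine norm_integral_le_of_norm_le (integrable_tri s) (Filter.Eventually.of_forall fun t => ?_)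
  rw [norm_mul, Real.norm_of_nonneg (tri_nonneg s t)]
  exact mul_le_of_le_one_right (tri_nonneg s t) (Real.abs_cos_le_one _)

theorem triHat_eq_cosTransform (s : ℝ) : triHat s = cosTransform (tri s) := by
  ext ξ
  unfold triHat cosTransform
  congr 1; ext t
  rw [real_inner_comm, RCLike.inner_apply, conj_trivial, ← mul_assoc]

theorem continuous_triHat (s : ℝ) : Continuous (triHat s) := by
  rw [triHat_eq_cosTransform]
  exact continuous_cosTransform (integrable_tri s) (tri_neg s)

theorem triHat_neg (s ξ : ℝ) : triHat s (-ξ) = triHat s ξ := by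
  rw [triHat_eq_cosTransform, cosTransform_neg]

/-- Boundedness and quadratic decay combine into an integrable majorant, which permits Fourier
inversion. -/
theorem abs_triHat_le_div {s : ℝ} (hs : 0 ≤ s) (ξ : ℝ) :
    |triHat s ξ| ≤ (s ^ 2 + 1) * (1 + ξ ^ 2)⁻¹ := by
  rw [← div_eq_mul_inv, le_div_iff₀ (by positivity)]
  have h1 := abs_triHat_le hs ξ
  have h2 : (Real.pi * ξ) ^ 2 * |triHat s ξ| ≤ 1 := by
    rw [← abs_of_nonneg (sq_nonneg (Real.pi * ξ)), ← abs_mul, sq_mul_triHat hs, abs_sq]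
    exact Real.sin_sq_le_one _
  have h3 : ξ ^ 2 * |triHat s ξ| ≤ (Real.pi * ξ) ^ 2 * |triHat s ξ| := by
    refine mul_le_mul_of_nonneg_right ?_ (abs_nonneg _)
    rw [mul_pow]
    have : 1 ≤ Real.pi ^ 2 := by nlinarith [Real.pi_gt_three]
    nlinarith [sq_nonneg ξ]
  linarith

theorem integrable_triHat {s : ℝ} (hs : 0 ≤ s) : Integrable (triHat s) :=
  (integrable_inv_one_add_sq.const_mul (s ^ 2 + 1)).mono' (continuous_triHat s).aestronglyMeasurable
    (Filter.Eventually.of_forall fun ξ => abs_triHat_le_div hs ξ)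

theorem integrable_triHat_mul_cos {s : ℝ} (hs : 0 ≤ s) (t : ℝ) :
    Integrable fun ξ => triHat s ξ * Real.cos (2 * Real.pi * t * ξ) :=
  (integrable_triHat hs).mul_bdd (c := 1) (by fun_prop)
    (Filter.Eventually.of_forall fun t => by simpa using Real.abs_cos_le_one _)

theorem integral_triHat_mul_cos {s : ℝ} (hs : 0 ≤ s) (t : ℝ) :
    ∫ ξ, triHat s ξ * Real.cos (2 * Real.pi * t * ξ) = tri s t := by
  have h := cosTransform_cosTransform (continuous_tri s) (integrable_tri s) (tri_neg s)
    (triHat_eq_cosTransform s ▸ integrable_triHat hs) t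
  rw [← triHat_eq_cosTransform] at h
  rw [← h, cosTransform]
  congr 1; ext ξ
  rw [RCLike.inner_apply, conj_trivial, ← mul_assoc]

theorem integrable_triHat_sq {s : ℝ} (hs : 0 ≤ s) : Integrable fun ξ => triHat s ξ ^ 2 := by
  simp_rw [sq]
  exact (integrable_triHat hs).mul_bdd (c := s ^ 2) (continuous_triHat s).aestronglyMeasurable
    (Filter.Eventually.of_forall fun t => abs_triHat_le hs t)

/-- The inverse Fourier transform of `triHat s ^ 2` is the autocorrelation of the triangle. -/
theorem integral_triHat_sq_mul_cos {s : ℝ} (hs : 0 ≤ s) (t : ℝ) :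
    ∫ ξ, triHat s ξ ^ 2 * Real.cos (2 * Real.pi * t * ξ) =
      ∫ u, tri s u * ((tri s (t + u) + tri s (t - u)) / 2) := by
  have hint : Integrable (Function.uncurry fun ξ u =>
      triHat s ξ * Real.cos (2 * Real.pi * t * ξ) *
        (tri s u * Real.cos (2 * Real.pi * u * ξ))) (volume.prod volume) := by
    have h1 := (integrable_triHat_mul_cos hs t).mul_prod (integrable_tri s)
    have h2 := h1.mul_bdd (c := 1) (g := fun z : ℝ × ℝ => Real.cos (2 * Real.pi * z.2 * z.1))
      (by fun_prop)
      (Filter.Eventually.of_forall fun t => by simpa using Real.abs_cos_le_one _)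
    refine h2.congr (Filter.Eventually.of_forall fun z => ?_)
    simp only [Function.uncurry]
    ring
  calc ∫ ξ, triHat s ξ ^ 2 * Real.cos (2 * Real.pi * t * ξ)
      = ∫ ξ, ∫ u, triHat s ξ * Real.cos (2 * Real.pi * t * ξ) *
        (tri s u * Real.cos (2 * Real.pi * u * ξ)) := by
        congr 1; ext ξ
        rw [integral_const_mul]
        change _ = _ * triHat s ξ
        ring
    _ = ∫ u, ∫ ξ, triHat s ξ * Real.cos (2 * Real.pi * t * ξ) *
        (tri s u * Real.cos (2 * Real.pi * u * ξ)) := integral_integral_swap hint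
    _ = _ := by
        congr 1; ext u
        rw [← integral_triHat_mul_cos hs (t + u), ← integral_triHat_mul_cos hs (t - u),
          ← integral_add (integrable_triHat_mul_cos hs _) (integrable_triHat_mul_cos hs _),
          ← integral_div, ← integral_const_mul]
        congr 1; ext ξ
        rw [show 2 * Real.pi * (t + u) * ξ = 2 * Real.pi * t * ξ + 2 * Real.pi * u * ξ by ring,
          show 2 * Real.pi * (t - u) * ξ = 2 * Real.pi * t * ξ - 2 * Real.pi * u * ξ by ring,
          Real.cos_add, Real.cos_sub]
        ring

/-- The autocorrelation of a function supported in `[-s, s]` is supported in `[-2s, 2s]`. -/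
theorem integral_triHat_sq_mul_cos_eq_zero {s t : ℝ} (hs : 0 ≤ s) (ht : 2 * s ≤ |t|) :
    ∫ ξ, triHat s ξ ^ 2 * Real.cos (2 * Real.pi * t * ξ) = 0 := by
  rw [integral_triHat_sq_mul_cos hs]
  have h : ∀ u, tri s u * ((tri s (t + u) + tri s (t - u)) / 2) = 0 := by
    intro u
    by_cases hu : s ≤ |u|
    · rw [tri_eq_zero hu, zero_mul]
    · push Not at hu
      have h1 := abs_sub_abs_le_abs_sub t u
      have h2 := abs_sub_abs_le_abs_sub t (-u)
      rw [abs_neg, sub_neg_eq_add] at h2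
      rw [tri_eq_zero (t := t + u) (by linarith), tri_eq_zero (t := t - u) (by linarith)]
      simp
  simp [h]

theorem integral_triHat_sq {s : ℝ} (hs : 0 ≤ s) : ∫ ξ, triHat s ξ ^ 2 = 2 * s ^ 3 / 3 := by
  have h := integral_triHat_sq_mul_cos hs 0
  simp only [mul_zero, zero_mul, Real.cos_zero, mul_one, zero_add, zero_sub, tri_neg,
    add_self_div_two] at h
  rw [h, integral_tri_sq hs]

/-- One factor `triHat` is traded with the square of the frequency for `sin²`, that is, for `1 -
cos`. The transform of the product is then a second difference of `tri`, which needs no derivatives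
and still vanishes for `2 * s ≤ |t|`. -/
theorem sq_mul_triHat_sq {s : ℝ} (hs : 0 ≤ s) (ξ : ℝ) :
    (2 * Real.pi * ξ) ^ 2 * triHat s ξ ^ 2 =
      2 * triHat s ξ - 2 * (triHat s ξ * Real.cos (2 * Real.pi * s * ξ)) := by
  have h : Real.cos (2 * Real.pi * s * ξ) = 1 - 2 * Real.sin (Real.pi * s * ξ) ^ 2 := by
    rw [show 2 * Real.pi * s * ξ = 2 * (Real.pi * s * ξ) by ring, Real.cos_two_mul, Real.cos_sq']
    ring
  rw [h, ← sq_mul_triHat hs]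
  ring

theorem integrable_sq_mul_triHat_sq {s : ℝ} (hs : 0 ≤ s) :
    Integrable fun ξ => (2 * Real.pi * ξ) ^ 2 * triHat s ξ ^ 2 := by
  simp_rw [sq_mul_triHat_sq hs]
  exact ((integrable_triHat hs).const_mul 2).sub ((integrable_triHat_mul_cos hs s).const_mul 2)

theorem integral_sq_mul_triHat_sq_mul_cos {s : ℝ} (hs : 0 ≤ s) (t : ℝ) :
    ∫ ξ, (2 * Real.pi * ξ) ^ 2 * triHat s ξ ^ 2 * Real.cos (2 * Real.pi * t * ξ) =
      2 * tri s t - (tri s (t + s) + tri s (t - s)) := by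
  have h0 := integrable_triHat_mul_cos hs t
  have h1 := integrable_triHat_mul_cos hs (t + s)
  have h2 := integrable_triHat_mul_cos hs (t - s)
  rw [← integral_triHat_mul_cos hs t, ← integral_triHat_mul_cos hs (t + s),
    ← integral_triHat_mul_cos hs (t - s), ← integral_const_mul, ← integral_add h1 h2,
    ← integral_sub (h0.const_mul 2) (g := fun ξ => _ + _) (h1.add h2)]
  congr 1; ext ξ
  rw [sq_mul_triHat_sq hs,
    show 2 * Real.pi * (t + s) * ξ = 2 * Real.pi * t * ξ + 2 * Real.pi * s * ξ by ring,
    show 2 * Real.pi * (t - s) * ξ = 2 * Real.pi * t * ξ - 2 * Real.pi * s * ξ by ring,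
    Real.cos_add, Real.cos_sub]
  ring

theorem integral_sq_mul_triHat_sq_mul_cos_eq_zero {s t : ℝ} (hs : 0 ≤ s) (ht : 2 * s ≤ |t|) :
    ∫ ξ, (2 * Real.pi * ξ) ^ 2 * triHat s ξ ^ 2 * Real.cos (2 * Real.pi * t * ξ) = 0 := by
  rw [integral_sq_mul_triHat_sq_mul_cos hs]
  have h1 := abs_sub_abs_le_abs_sub t s
  have h2 := abs_sub_abs_le_abs_sub t (-s)
  rw [abs_neg, sub_neg_eq_add, abs_of_nonneg hs] at h2
  rw [abs_of_nonneg hs] at h1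
  rw [tri_eq_zero (t := t) (by linarith), tri_eq_zero (t := t + s) (by linarith),
    tri_eq_zero (t := t - s) (by linarith)]
  simp

theorem integral_sq_mul_triHat_sq {s : ℝ} (hs : 0 ≤ s) :
    ∫ ξ, (2 * Real.pi * ξ) ^ 2 * triHat s ξ ^ 2 = 2 * s := by
  have h := integral_sq_mul_triHat_sq_mul_cos hs 0
  simp only [mul_zero, zero_mul, Real.cos_zero, mul_one, zero_add, zero_sub, tri_neg] at h
  rw [h, tri_zero hs, tri_eq_zero (le_abs_self s)]
  ring

end Multiscale

namespace Multiscale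

/-! ### A band-limited minorant in several variables -/

section Product

variable {d : ℕ}

theorem integrable_prod_apply {f : Fin d → ℝ → ℝ} (hf : ∀ i, Integrable (f i)) :
    Integrable fun ξ : EuclideanSpace ℝ (Fin d) => ∏ i, f i (ξ i) :=
  (PiLp.volume_preserving_ofLp (Fin d)).integrable_comp_of_integrable
    (g := fun ξ : Fin d → ℝ => ∏ i, f i (ξ i)) (Integrable.fintype_prod hf)

/-- The cosine of a sum does not factor, but the complex exponential does; so the identity is proved
for `𝓕` and read back through evenness. -/
theorem cosTransform_prod {f : Fin d → ℝ → ℝ} (hf : ∀ i, Integrable (f i))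
    (heven : ∀ i t, f i (-t) = f i t) (x : EuclideanSpace ℝ (Fin d)) :
    cosTransform (fun ξ : EuclideanSpace ℝ (Fin d) => ∏ i, f i (ξ i)) x =
      ∏ i, cosTransform (f i) (x i) := by
  have h := fourier_ofReal_even (integrable_prod_apply hf)
    (fun t => by simp [heven]) x
  rw [← Complex.ofReal_inj, ← h, Complex.ofReal_prod]
  simp_rw [← fun i => fourier_ofReal_even (hf i) (heven i) (x i), Real.fourier_eq',
    ← integral_fintype_prod_volume_eq_prod]
  rw [← (PiLp.volume_preserving_ofLp (Fin d)).integral_comp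
    (MeasurableEquiv.toLp 2 (Fin d → ℝ)).symm.measurableEmbedding]
  congr 1; ext ξ
  simp only [smul_eq_mul, Finset.prod_mul_distrib, ← Complex.exp_sum, ← Finset.sum_mul,
    ← Complex.ofReal_sum, ← Complex.ofReal_prod, ← Finset.mul_sum, PiLp.inner_apply]

end Product

theorem cosTransform_real (g : ℝ → ℝ) (t : ℝ) :
    cosTransform g t = ∫ ξ, g ξ * Real.cos (2 * Real.pi * t * ξ) := by
  unfold cosTransform
  congr 1; ext ξ
  rw [RCLike.inner_apply, conj_trivial, ← mul_assoc]

/-- A function that is at most `R² s^(4d)` on the ball of radius `R / (2π)` and nonpositive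
outside, and whose Fourier transform has compact support. -/
noncomputable def minorant {d : ℕ} (s R : ℝ) (ξ : EuclideanSpace ℝ (Fin d)) : ℝ :=
  (R ^ 2 - (2 * Real.pi * ‖ξ‖) ^ 2) * ∏ i, triHat s (ξ i) ^ 2

/-- The factors of the summands of `minorant`. -/
noncomputable def minorantFactor {d : ℕ} (s : ℝ) (i j : Fin d) (t : ℝ) : ℝ :=
  if j = i then (2 * Real.pi * t) ^ 2 * triHat s t ^ 2 else triHat s t ^ 2

section Minorant

variable {d : ℕ} {s : ℝ}

/-- Writing `‖ξ‖ ^ 2` as a sum over coordinates makes every summand a product of functions of one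
variable, to which `cosTransform_prod` applies. -/
theorem minorant_eq (s R : ℝ) :
    minorant (d := d) s R = fun ξ => R ^ 2 * ∏ i, triHat s (ξ i) ^ 2 -
      ∑ i, ∏ j, minorantFactor s i j (ξ j) := by
  ext ξ
  have h : ∀ i, ∏ j, minorantFactor s i j (ξ j) =
      (2 * Real.pi * ξ i) ^ 2 * ∏ j, triHat s (ξ j) ^ 2 := by
    intro i
    have h1 : ∀ j, minorantFactor s i j (ξ j) =
        (if j = i then (2 * Real.pi * ξ j) ^ 2 else 1) * triHat s (ξ j) ^ 2 := by
      intro j; unfold minorantFactor; split_ifs <;> simp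
    simp_rw [h1, Finset.prod_mul_distrib]
    simp
  simp_rw [h, ← Finset.sum_mul, ← sub_mul]
  rw [minorant, mul_pow, EuclideanSpace.real_norm_sq_eq, Finset.mul_sum]
  simp_rw [mul_pow]

theorem integrable_minorantFactor (hs : 0 ≤ s) (i j : Fin d) :
    Integrable (minorantFactor s i j) := by
  unfold minorantFactor
  split_ifs
  · exact integrable_sq_mul_triHat_sq hs
  · exact integrable_triHat_sq hs

theorem minorantFactor_neg (i j : Fin d) (t : ℝ) :
    minorantFactor s i j (-t) = minorantFactor s i j t := by
  simp [minorantFactor, triHat_neg]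

theorem integrable_minorant (hs : 0 ≤ s) (R : ℝ) : Integrable (minorant (d := d) s R) := by
  rw [minorant_eq]
  exact ((integrable_prod_apply fun _ => integrable_triHat_sq hs).const_mul _).sub
    (integrable_finsetSum _ fun i _ =>
      integrable_prod_apply fun j => integrable_minorantFactor hs i j)

theorem cosTransform_minorant (hs : 0 ≤ s) (R : ℝ) (x : EuclideanSpace ℝ (Fin d)) :
    cosTransform (minorant s R) x =
      R ^ 2 * ∏ i, cosTransform (fun t => triHat s t ^ 2) (x i) -
        ∑ i, ∏ j, cosTransform (minorantFactor s i j) (x j) := by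
  have h0 := integrable_prod_apply (d := d) fun _ => integrable_triHat_sq hs
  have h1 := fun i : Fin d => integrable_prod_apply (integrable_minorantFactor hs i)
  rw [← cosTransform_prod (fun _ => integrable_triHat_sq hs)
    (fun _ t => by rw [triHat_neg]) x]
  simp_rw [← fun i : Fin d => cosTransform_prod (integrable_minorantFactor hs i)
    (minorantFactor_neg i) x]
  unfold cosTransform
  rw [← integral_const_mul, ← integral_finsetSum _ fun i _ => integrable_mul_cos_inner (h1 i) x,
    ← integral_sub ((integrable_mul_cos_inner h0 x).const_mul _)
      (integrable_finsetSum _ fun i _ => integrable_mul_cos_inner (h1 i) x)]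
  congr 1; ext ξ
  rw [minorant_eq, sub_mul, Finset.sum_mul, mul_assoc]

/-- A single large coordinate is enough, because it annihilates one factor of every product. -/
theorem cosTransform_minorant_eq_zero (hs : 0 ≤ s) (R : ℝ) {x : EuclideanSpace ℝ (Fin d)}
    {i₀ : Fin d} (hx : 2 * s ≤ |x i₀|) : cosTransform (minorant s R) x = 0 := by
  rw [cosTransform_minorant hs, Finset.prod_eq_zero (Finset.mem_univ i₀)
    (by rw [cosTransform_real, integral_triHat_sq_mul_cos_eq_zero hs hx]), mul_zero, zero_sub,
    neg_eq_zero]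
  refine Finset.sum_eq_zero fun i _ => Finset.prod_eq_zero (Finset.mem_univ i₀) ?_
  rw [cosTransform_real]
  unfold minorantFactor
  split_ifs
  · exact integral_sq_mul_triHat_sq_mul_cos_eq_zero hs hx
  · exact integral_triHat_sq_mul_cos_eq_zero hs hx

theorem cosTransform_minorant_zero (hs : 0 < s) (R : ℝ) :
    cosTransform (minorant (d := d) s R) 0 =
      (2 * s ^ 3 / 3) ^ d * (R ^ 2 - 3 * d / s ^ 2) := by
  have h : ∀ i j : Fin d, cosTransform (minorantFactor s i j) 0 =
      (if j = i then 3 / s ^ 2 else 1) * (2 * s ^ 3 / 3) := by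
    intro i j
    simp only [cosTransform_real, mul_zero, zero_mul, Real.cos_zero, mul_one]
    unfold minorantFactor
    split_ifs
    · rw [integral_sq_mul_triHat_sq hs.le]; field_simp
    · rw [integral_triHat_sq hs.le, one_mul]
  rw [cosTransform_minorant hs.le]
  simp only [PiLp.zero_apply, h, Finset.prod_mul_distrib, Finset.prod_const, Finset.card_univ,
    Fintype.card_fin, Finset.prod_ite_eq', Finset.mem_univ, if_true, Finset.sum_const,
    nsmul_eq_mul, cosTransform_real, mul_zero, zero_mul, Real.cos_zero, mul_one,
    integral_triHat_sq hs.le]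
  ring

theorem minorant_le (hs : 0 ≤ s) {R : ℝ} (hR : 0 ≤ R) (ξ : EuclideanSpace ℝ (Fin d)) :
    minorant s R ξ ≤ if 2 * Real.pi * ‖ξ‖ ≤ R then R ^ 2 * (s ^ 4) ^ d else 0 := by
  have hnn : 0 ≤ 2 * Real.pi * ‖ξ‖ := by have := Real.pi_pos; positivity
  have h0 : 0 ≤ ∏ i, triHat s (ξ i) ^ 2 := Finset.prod_nonneg fun _ _ => sq_nonneg _
  split_ifs with h
  · unfold minorant
    gcongr
    · nlinarith
    · calc ∏ i, triHat s (ξ i) ^ 2 ≤ ∏ _i : Fin d, s ^ 4 := by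
            refine Finset.prod_le_prod (fun _ _ => sq_nonneg _) fun i _ => ?_
            rw [← sq_abs, show s ^ 4 = (s ^ 2) ^ 2 by ring]
            gcongr
            exact abs_triHat_le hs _
        _ = (s ^ 4) ^ d := by simp
  · refine mul_nonpos_of_nonpos_of_nonneg ?_ h0
    push Not at h
    nlinarith

theorem exists_le_abs_apply {r : ℝ} (hd : 1 ≤ d) (hr : 0 ≤ r) {x : EuclideanSpace ℝ (Fin d)}
    (hx : r ≤ ‖x‖) : ∃ i, r / √(d : ℝ) ≤ |x i| := by
  have hd0 : (0 : ℝ) < d := by exact_mod_cast hd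
  have : Nonempty (Fin d) := ⟨⟨0, hd⟩⟩
  by_contra! h
  have h1 : ∑ i, x i ^ 2 < ∑ _i : Fin d, (r / √(d : ℝ)) ^ 2 := by
    refine Finset.sum_lt_sum_of_nonempty Finset.univ_nonempty fun i _ => ?_
    rw [← sq_abs]
    have := h i
    gcongr
  rw [← EuclideanSpace.real_norm_sq_eq] at h1
  simp only [Finset.sum_const, Finset.card_univ, Fintype.card_fin, nsmul_eq_mul, div_pow,
    Real.sq_sqrt hd0.le] at h1
  rw [mul_div_cancel₀ _ hd0.ne'] at h1
  nlinarith

end Minorant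

/-! ### Lower bounds for quadratic forms -/

section Quadratic

variable {d : ℕ} {ι : Type*} [Fintype ι]

/-- The bracket is the squared modulus of the trigonometric sum `∑ α_j exp(2πi ξ·y_j)`. Its
nonnegativity makes the quadratic form monotone in `g`. -/
theorem sum_sum_mul_cosTransform {g : EuclideanSpace ℝ (Fin d) → ℝ} (hg : Integrable g)
    (y : ι → EuclideanSpace ℝ (Fin d)) (α : ι → ℝ) :
    ∑ j, ∑ k, α j * α k * cosTransform g (y j - y k) =
      ∫ ξ, g ξ * ((∑ j, α j * Real.cos (2 * Real.pi * inner ℝ ξ (y j))) ^ 2 +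
        (∑ j, α j * Real.sin (2 * Real.pi * inner ℝ ξ (y j))) ^ 2) := by
  unfold cosTransform
  simp_rw [← integral_const_mul]
  have h := fun j k => (integrable_mul_cos_inner hg (y j - y k)).const_mul (α j * α k)
  simp_rw [← fun j => integral_finsetSum Finset.univ fun k _ => h j k]
  rw [← integral_finsetSum _ fun j _ => integrable_finsetSum _ fun k _ => h j k]
  congr 1; ext ξ
  rw [sq, sq, Finset.sum_mul_sum, Finset.sum_mul_sum, ← Finset.sum_add_distrib, Finset.mul_sum]
  refine Finset.sum_congr rfl fun j _ => ?_
  rw [← Finset.sum_add_distrib, Finset.mul_sum]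
  refine Finset.sum_congr rfl fun k _ => ?_
  rw [inner_sub_right, mul_sub, Real.cos_sub]
  ring

theorem integrable_mul_sum_sq {g : EuclideanSpace ℝ (Fin d) → ℝ} (hg : Integrable g)
    (y : ι → EuclideanSpace ℝ (Fin d)) (α : ι → ℝ) :
    Integrable fun ξ => g ξ * ((∑ j, α j * Real.cos (2 * Real.pi * inner ℝ ξ (y j))) ^ 2 +
        (∑ j, α j * Real.sin (2 * Real.pi * inner ℝ ξ (y j))) ^ 2) := by
  refine hg.mul_bdd (c := (∑ j, |α j|) ^ 2 + (∑ j, |α j|) ^ 2)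
    (Continuous.aestronglyMeasurable (by fun_prop)) (Filter.Eventually.of_forall fun ξ => ?_)
  rw [Real.norm_of_nonneg (by positivity)]
  have h1 : |∑ j, α j * Real.cos (2 * Real.pi * inner ℝ ξ (y j))| ≤ ∑ j, |α j| := by
    refine (Finset.abs_sum_le_sum_abs _ _).trans (Finset.sum_le_sum fun j _ => ?_)
    rw [abs_mul]
    exact mul_le_of_le_one_right (abs_nonneg _) (Real.abs_cos_le_one _)
  have h2 : |∑ j, α j * Real.sin (2 * Real.pi * inner ℝ ξ (y j))| ≤ ∑ j, |α j| := by
    refine (Finset.abs_sum_le_sum_abs _ _).trans (Finset.sum_le_sum fun j _ => ?_)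
    rw [abs_mul]
    exact mul_le_of_le_one_right (abs_nonneg _) (Real.abs_sin_le_one _)
  exact add_le_add (sq_le_sq' (abs_le.mp h1).1 (abs_le.mp h1).2)
    (sq_le_sq' (abs_le.mp h2).1 (abs_le.mp h2).2)

/-- An Ingham type inequality: a quadratic form of a positive definite function on points of
distance at least `2 r` is bounded from below by the values of its Fourier transform on a ball. -/
theorem le_sum_sum_mul_cosTransform {F : EuclideanSpace ℝ (Fin d) → ℝ} (hd : 1 ≤ d)
    (hF : Integrable F) (hF0 : ∀ ξ, 0 ≤ F ξ) {r R c : ℝ} (hr : 0 < r) (hR : 0 < R) (hc : 0 ≤ c)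
    (hcF : ∀ ξ, 2 * Real.pi * ‖ξ‖ ≤ R → c ≤ F ξ) (y : ι → EuclideanSpace ℝ (Fin d))
    (hy : ∀ j k, j ≠ k → 2 * r ≤ ‖y j - y k‖) (α : ι → ℝ) :
    c * ((2 * √(d : ℝ) / (3 * r)) ^ d * (1 - 3 * d ^ 2 / (r ^ 2 * R ^ 2))) * ∑ j, α j ^ 2 ≤
      ∑ j, ∑ k, α j * α k * cosTransform F (y j - y k) := by
  classical
  have hd0 : (0 : ℝ) < d := by exact_mod_cast hd
  have hsd : 0 < √(d : ℝ) := Real.sqrt_pos.mpr hd0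
  -- Two points of distance at least `2 r` differ by at least `2 r / √d = 2 s` in some coordinate,
  -- which is where the transform of the minorant vanishes.
  set s := r / √(d : ℝ) with hs_def
  have hs : 0 < s := by positivity
  have hm := integrable_minorant (d := d) hs.le R
  have h1 : ∑ j, ∑ k, α j * α k * cosTransform (minorant s R) (y j - y k) =
      (2 * s ^ 3 / 3) ^ d * (R ^ 2 - 3 * d / s ^ 2) * ∑ j, α j ^ 2 := by
    rw [Finset.mul_sum]
    refine Finset.sum_congr rfl fun j _ => ?_
    rw [Finset.sum_eq_single j]
    · rw [sub_self, cosTransform_minorant_zero hs]; ring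
    · intro k _ hkj
      obtain ⟨i, hi⟩ := exists_le_abs_apply hd (by positivity) (hy j k hkj.symm)
      rw [cosTransform_minorant_eq_zero hs.le R (i₀ := i)
        (by rw [hs_def, ← mul_div_assoc]; exact hi), mul_zero]
    · simp
  -- The scaling makes the minorant at most `c` on the ball; outside it is nonpositive and `F` is
  -- nonnegative.
  have hk : ∀ ξ, c / (R ^ 2 * (s ^ 4) ^ d) * minorant s R ξ ≤ F ξ := by
    intro ξ
    have := minorant_le hs.le hR.le ξ
    split_ifs at this with h
    · calc c / (R ^ 2 * (s ^ 4) ^ d) * minorant s R ξ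
          ≤ c / (R ^ 2 * (s ^ 4) ^ d) * (R ^ 2 * (s ^ 4) ^ d) := by gcongr
        _ = c := by field_simp
        _ ≤ F ξ := hcF ξ h
    · exact (mul_nonpos_of_nonneg_of_nonpos (by positivity) this).trans (hF0 ξ)
  have h2 : c / (R ^ 2 * (s ^ 4) ^ d) *
      ∑ j, ∑ k, α j * α k * cosTransform (minorant s R) (y j - y k) ≤
        ∑ j, ∑ k, α j * α k * cosTransform F (y j - y k) := by
    rw [sum_sum_mul_cosTransform hm, sum_sum_mul_cosTransform hF, ← integral_const_mul]
    refine integral_mono ((integrable_mul_sum_sq hm y α).const_mul _)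
      (integrable_mul_sum_sq hF y α) fun ξ => ?_
    simp only
    rw [← mul_assoc]
    exact mul_le_mul_of_nonneg_right (hk ξ) (by positivity)
  refine le_trans (le_of_eq ?_) h2
  rw [h1]
  have e1 : (2 * √(d : ℝ) / (3 * r)) = (2 * s ^ 3 / 3) / s ^ 4 := by
    rw [hs_def]; field_simp
  have e2 : (3 * (d : ℝ) ^ 2 / (r ^ 2 * R ^ 2)) = 3 * d / s ^ 2 / R ^ 2 := by
    rw [hs_def, div_pow, Real.sq_sqrt hd0.le]; field_simp
  rw [e1, e2, div_pow]
  field_simp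

end Quadratic

end Multiscale

namespace Multiscale

/-! ### Properties of the kernel -/

namespace IsKernel

variable {d : ℕ} {Φ : EuclideanSpace ℝ (Fin d) → ℝ} {τ cΦ CΦ : ℝ}

theorem even (hΦ : IsKernel Φ τ cΦ CΦ) (x : EuclideanSpace ℝ (Fin d)) : Φ (-x) = Φ x := by
  obtain ⟨φ, h⟩ := hΦ.radial
  rw [h, h, norm_neg]

theorem integrable (hΦ : IsKernel Φ τ cΦ CΦ) : Integrable Φ :=
  hΦ.continuous.integrable_of_hasCompactSupport
    (HasCompactSupport.of_support_subset_isCompact (isCompact_closedBall 0 1)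
      ((subset_tsupport Φ).trans hΦ.support))

/-- On the unit sphere the value is the limit along the ray from outside. The non-strict inequality
is needed for bandedness and for the case `δ ≤ 2 * q`. -/
theorem eq_zero (hΦ : IsKernel Φ τ cΦ CΦ) {x : EuclideanSpace ℝ (Fin d)} (hx : 1 ≤ ‖x‖) :
    Φ x = 0 := by
  have h1 : ∀ y : EuclideanSpace ℝ (Fin d), 1 < ‖y‖ → Φ y = 0 := fun y hy =>
    image_eq_zero_of_notMem_tsupport fun h => by
      have := hΦ.support h
      rw [mem_closedBall_zero_iff] at this
      linarith
  have h2 : Filter.Tendsto (fun t : ℝ => Φ (t • x)) (nhdsWithin 1 (Set.Ioi 1)) (nhds (Φ x)) := by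
    have h : ContinuousAt (fun t : ℝ => Φ (t • x)) 1 := by
      have := hΦ.continuous
      fun_prop
    simpa using h.tendsto.mono_left nhdsWithin_le_nhds
  refine tendsto_nhds_unique_of_eventuallyEq h2 tendsto_const_nhds ?_
  filter_upwards [self_mem_nhdsWithin] with t ht
  refine h1 _ ?_
  have ht : 1 < t := ht
  rw [norm_smul, Real.norm_of_nonneg (by linarith)]
  nlinarith

theorem cosTransform_eq (hΦ : IsKernel Φ τ cΦ CΦ) (ξ : EuclideanSpace ℝ (Fin d)) :
    cosTransform Φ ξ = √(2 * Real.pi) ^ d * fourierHat Φ ((2 * Real.pi) • ξ) := by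
  have hpi : (0 : ℝ) < 2 * Real.pi := by have := Real.pi_pos; positivity
  have h1 : √(2 * Real.pi) ^ d = (2 * Real.pi) ^ ((d : ℝ) / 2) := by
    rw [Real.sqrt_eq_rpow, ← Real.rpow_natCast, ← Real.rpow_mul hpi.le]
    congr 1; ring
  rw [fourierHat, smul_smul, inv_mul_cancel₀ hpi.ne', one_smul,
    fourier_ofReal_even hΦ.integrable hΦ.even, Complex.ofReal_re, h1, ← mul_assoc,
    ← Real.rpow_add hpi, neg_div, add_neg_cancel, Real.rpow_zero, one_mul]

theorem le_cosTransform (hΦ : IsKernel Φ τ cΦ CΦ) (ξ : EuclideanSpace ℝ (Fin d)) :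
    √(2 * Real.pi) ^ d * (cΦ * (1 + (2 * Real.pi * ‖ξ‖) ^ 2) ^ (-τ)) ≤ cosTransform Φ ξ := by
  rw [hΦ.cosTransform_eq]
  have h := hΦ.lower ((2 * Real.pi) • ξ)
  rw [norm_smul, Real.norm_of_nonneg (by have := Real.pi_pos; positivity)] at h
  gcongr

theorem cosTransform_le (hΦ : IsKernel Φ τ cΦ CΦ) (ξ : EuclideanSpace ℝ (Fin d)) :
    cosTransform Φ ξ ≤ √(2 * Real.pi) ^ d * (CΦ * (1 + (2 * Real.pi * ‖ξ‖) ^ 2) ^ (-τ)) := by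
  rw [hΦ.cosTransform_eq]
  have h := hΦ.upper ((2 * Real.pi) • ξ)
  rw [norm_smul, Real.norm_of_nonneg (by have := Real.pi_pos; positivity)] at h
  gcongr

theorem cosTransform_pos (hΦ : IsKernel Φ τ cΦ CΦ) (ξ : EuclideanSpace ℝ (Fin d)) :
    0 < cosTransform Φ ξ := by
  refine lt_of_lt_of_le ?_ (hΦ.le_cosTransform ξ)
  have := hΦ.cΦ_pos
  have := Real.pi_pos
  positivity

theorem tau_pos (hΦ : IsKernel Φ τ cΦ CΦ) : 0 < τ :=
  lt_of_le_of_lt (by positivity) hΦ.tau_gt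

/-- The decay exponent `2 τ` exceeds the dimension. -/
theorem integrable_cosTransform (hΦ : IsKernel Φ τ cΦ CΦ) : Integrable (cosTransform Φ) := by
  have h1 : Integrable fun ξ : EuclideanSpace ℝ (Fin d) => (1 + ‖ξ‖ ^ 2) ^ (-(2 * τ) / 2) := by
    refine integrable_rpow_neg_one_add_norm_sq ?_
    rw [finrank_euclideanSpace_fin]
    linarith [hΦ.tau_gt]
  refine (h1.const_mul (√(2 * Real.pi) ^ d * CΦ)).mono'
    (continuous_cosTransform hΦ.integrable hΦ.even).aestronglyMeasurable
    (Filter.Eventually.of_forall fun ξ => ?_)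
  rw [Real.norm_of_nonneg (hΦ.cosTransform_pos ξ).le, mul_assoc]
  refine (hΦ.cosTransform_le ξ).trans ?_
  have := hΦ.CΦ_pos
  have h2 : -(2 * τ) / 2 = -τ := by ring
  rw [h2]
  gcongr √(2 * Real.pi) ^ d * (CΦ * ?_)
  refine Real.rpow_le_rpow_of_nonpos (by positivity) ?_ (by linarith [hΦ.tau_pos])
  have : 1 ≤ 2 * Real.pi := by linarith [Real.pi_gt_three]
  have : ‖ξ‖ ≤ 2 * Real.pi * ‖ξ‖ := by nlinarith [norm_nonneg ξ]
  gcongr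

theorem cosTransform_cosTransform (hΦ : IsKernel Φ τ cΦ CΦ) (x : EuclideanSpace ℝ (Fin d)) :
    cosTransform (cosTransform Φ) x = Φ x :=
  Multiscale.cosTransform_cosTransform hΦ.continuous hΦ.integrable hΦ.even
    hΦ.integrable_cosTransform x

/-- By inversion `Φ x` is an integral of the positive transform against a cosine, and at the origin
the cosine is one. -/
theorem abs_le (hΦ : IsKernel Φ τ cΦ CΦ) (x : EuclideanSpace ℝ (Fin d)) : |Φ x| ≤ Φ 0 := by
  rw [← hΦ.cosTransform_cosTransform x, ← hΦ.cosTransform_cosTransform 0]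
  have h0 : cosTransform (cosTransform Φ) 0 = ∫ ξ, cosTransform Φ ξ := by
    rw [cosTransform]; simp
  rw [h0, ← Real.norm_eq_abs]
  refine norm_integral_le_of_norm_le hΦ.integrable_cosTransform
    (Filter.Eventually.of_forall fun ξ => ?_)
  rw [norm_mul, Real.norm_of_nonneg (hΦ.cosTransform_pos ξ).le]
  exact mul_le_of_le_one_right (hΦ.cosTransform_pos ξ).le (Real.abs_cos_le_one _)

/-- The transform at frequency zero is `∫ Φ`, which is at most the volume of the unit ball times `Φ
0`; the assumed lower bound at frequency zero gives the other side. -/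
theorem le_apply_zero (hΦ : IsKernel Φ τ cΦ CΦ) (hd : 1 ≤ d) :
    √(2 * Real.pi) ^ d * cΦ ≤ √Real.pi ^ d / Real.Gamma ((d : ℝ) / 2 + 1) * Φ 0 := by
  have h1 := hΦ.le_cosTransform 0
  simp only [norm_zero, mul_zero, ne_eq, OfNat.ofNat_ne_zero, not_false_eq_true, zero_pow, add_zero,
    Real.one_rpow, mul_one] at h1
  refine h1.trans ?_
  have hvol : volume.real (Metric.closedBall (0 : EuclideanSpace ℝ (Fin d)) 1) =
      √Real.pi ^ d / Real.Gamma ((d : ℝ) / 2 + 1) := by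
    have : Nonempty (Fin d) := ⟨⟨0, hd⟩⟩
    have hG := Gamma_half_pos d
    rw [measureReal_def, EuclideanSpace.volume_closedBall, ENNReal.ofReal_one, one_pow, one_mul,
      Fintype.card_fin, ENNReal.toReal_ofReal (by positivity)]
  have h0 : cosTransform Φ 0 = ∫ x in Metric.closedBall 0 1, Φ x := by
    rw [cosTransform, setIntegral_eq_integral_of_forall_compl_eq_zero]
    · simp
    · intro x hx
      rw [mem_closedBall_zero_iff, not_le] at hx
      exact hΦ.eq_zero hx.le
  rw [h0, ← hvol, mul_comm]
  refine (le_abs_self _).trans ?_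
  exact norm_setIntegral_le_of_norm_le_const (f := Φ) measure_closedBall_lt_top
    fun x _ => hΦ.abs_le x

theorem apply_zero_pos (hΦ : IsKernel Φ τ cΦ CΦ) (hd : 1 ≤ d) : 0 < Φ 0 := by
  have h := hΦ.le_apply_zero hd
  have h1 : 0 < √(2 * Real.pi) ^ d * cΦ := by
    have := hΦ.cΦ_pos
    have := Real.pi_pos
    positivity
  have h2 := h1.trans_le h
  have := Gamma_half_pos d
  exact pos_of_mul_pos_right h2 (by positivity)

theorem three_mul_le (hΦ : IsKernel Φ τ cΦ CΦ) (hd : 1 ≤ d) :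
    3 * (1 / 3) ^ d ≤ Φ 0 * (constCd d * cΦ)⁻¹ := by
  refine (three_mul_le_div_constCd hd).trans ?_
  have hc := hΦ.cΦ_pos
  have hC := constCd_pos d
  have hG := Gamma_half_pos d
  have hpi := Real.pi_pos
  rw [← div_eq_mul_inv, div_le_div_iff₀ hC (by positivity)]
  have h := hΦ.le_apply_zero hd
  have h1 : √(2 * Real.pi) ^ d = √2 ^ d * √Real.pi ^ d := by
    rw [Real.sqrt_mul (by norm_num), mul_pow]
  rw [h1, div_mul_eq_mul_div, le_div_iff₀ hG] at h
  have h2 : √2 ^ d * cΦ * Real.Gamma ((d : ℝ) / 2 + 1) ≤ Φ 0 := by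
    refine le_of_mul_le_mul_left ?_ (show 0 < √Real.pi ^ d by positivity)
    linarith
  nlinarith

/-- The lower bound for the quadratic form of the kernel on points of distance at least `2 r`. -/
theorem le_sum_sum (hΦ : IsKernel Φ τ cΦ CΦ) (hd : 1 ≤ d) {ι : Type*} [Fintype ι] {r : ℝ}
    (hr : 0 < r) (y : ι → EuclideanSpace ℝ (Fin d)) (hy : ∀ j k, j ≠ k → 2 * r ≤ ‖y j - y k‖)
    (α : ι → ℝ) :
    constCd d * cΦ * (1 + 4 * constM d ^ 2 / r ^ 2) ^ (-τ) * (1 / (2 * r)) ^ d * ∑ j, α j ^ 2 ≤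
      ∑ j, ∑ k, α j * α k * Φ (y j - y k) := by
  have hc := hΦ.cΦ_pos
  have hC := constCd_pos d
  have hM := constM_pos d
  have hpi := Real.pi_pos
  -- With this radius `r ^ 2 * R ^ 2 = 4 * constM d ^ 2`, so the factor to be compared with `C_d` in
  -- `constCd_le` no longer depends on `r`.
  set R := 2 * constM d / r with hR
  set c := √(2 * Real.pi) ^ d * (cΦ * (1 + R ^ 2) ^ (-τ)) with hcdef
  have h := le_sum_sum_mul_cosTransform hd hΦ.integrable_cosTransform
    (fun ξ => (hΦ.cosTransform_pos ξ).le) hr (R := R) (c := c) (by positivity) (by positivity)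
    (fun ξ hξ => by
      refine le_trans ?_ (hΦ.le_cosTransform ξ)
      rw [hcdef]
      gcongr √(2 * Real.pi) ^ d * (cΦ * ?_)
      refine Real.rpow_le_rpow_of_nonpos (by positivity) ?_ (by linarith [hΦ.tau_pos])
      gcongr) y hy α
  simp_rw [hΦ.cosTransform_cosTransform] at h
  refine le_trans ?_ h
  gcongr ?_ * _
  have e1 : R ^ 2 = 4 * constM d ^ 2 / r ^ 2 := by rw [hR, div_pow]; ring
  have e2 : 3 * (d : ℝ) ^ 2 / (r ^ 2 * R ^ 2) = 3 * (d : ℝ) ^ 2 / (4 * constM d ^ 2) := by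
    rw [e1]; field_simp
  rw [hcdef, ← e1, e2]
  calc constCd d * cΦ * (1 + R ^ 2) ^ (-τ) * (1 / (2 * r)) ^ d
      = cΦ * (1 + R ^ 2) ^ (-τ) * (constCd d * (1 / 2) ^ d) * (1 / r) ^ d := by
        rw [show 1 / (2 * r) = 1 / 2 * (1 / r) by field_simp, mul_pow]; ring
    _ ≤ cΦ * (1 + R ^ 2) ^ (-τ) * (√(2 * Real.pi) ^ d * (2 * √(d : ℝ) / 3) ^ d *
      (1 - 3 * (d : ℝ) ^ 2 / (4 * constM d ^ 2))) * (1 / r) ^ d := by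
        gcongr _ * ?_ * _
        exact constCd_le hd
    _ = _ := by
        rw [show 2 * √(d : ℝ) / (3 * r) = 2 * √(d : ℝ) / 3 * (1 / r) by field_simp, mul_pow]; ring

end IsKernel

end Multiscale

namespace Multiscale

/-! ### Exponential decay of inverses of banded matrices -/

section Spectral

variable {n : Type*} [Fintype n] [DecidableEq n]

theorem exists_orthogonal_diagonalization {A : Matrix n n ℝ} (hA : A.IsHermitian) {a b : ℝ}
    (ha : ∀ v : n → ℝ, a * ∑ i, v i ^ 2 ≤ v ⬝ᵥ A *ᵥ v)
    (hb : ∀ v : n → ℝ, v ⬝ᵥ A *ᵥ v ≤ b * ∑ i, v i ^ 2) :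
    ∃ (U : Matrix n n ℝ) (l : n → ℝ), U * Uᵀ = 1 ∧ Uᵀ * U = 1 ∧ A = U * diagonal l * Uᵀ ∧
      ∀ i, a ≤ l i ∧ l i ≤ b := by
  refine ⟨hA.eigenvectorUnitary, hA.eigenvalues, ?_, ?_, ?_, fun i => ?_⟩
  · have := Unitary.coe_mul_star_self hA.eigenvectorUnitary
    rwa [Unitary.coe_star, star_eq_conjTranspose, conjTranspose_eq_transpose_of_trivial] at this
  · have := Unitary.coe_star_mul_self hA.eigenvectorUnitary
    rwa [star_eq_conjTranspose, conjTranspose_eq_transpose_of_trivial] at this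
  · have := hA.spectral_theorem
    rwa [Unitary.conjStarAlgAut_apply, star_eq_conjTranspose,
      conjTranspose_eq_transpose_of_trivial] at this
  · have h := hA.eigenvalues_eq i
    rw [star_trivial, RCLike.re_to_real] at h
    have h1 : ∑ j, (hA.eigenvectorBasis i) j ^ 2 = 1 := by
      rw [← EuclideanSpace.real_norm_sq_eq, hA.eigenvectorBasis.orthonormal.1 i, one_pow]
    have h2 := ha (hA.eigenvectorBasis i)
    have h3 := hb (hA.eigenvectorBasis i)
    rw [h1, mul_one, ← h] at h2 h3
    exact ⟨h2, h3⟩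

theorem mul_diagonal_mul_transpose_mul {U : Matrix n n ℝ} (hU : Uᵀ * U = 1) (v w : n → ℝ) :
    (U * diagonal v * Uᵀ) * (U * diagonal w * Uᵀ) = U * diagonal (fun i => v i * w i) * Uᵀ := by
  calc (U * diagonal v * Uᵀ) * (U * diagonal w * Uᵀ)
      = U * diagonal v * (Uᵀ * U) * diagonal w * Uᵀ := by simp only [Matrix.mul_assoc]
    _ = U * (diagonal v * diagonal w) * Uᵀ := by rw [hU, Matrix.mul_one, Matrix.mul_assoc U]
    _ = _ := by rw [diagonal_mul_diagonal]

theorem aeval_mul_diagonal_mul_transpose {U : Matrix n n ℝ} (hU : U * Uᵀ = 1) (hU' : Uᵀ * U = 1)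
    (l : n → ℝ) (p : Polynomial ℝ) :
    Polynomial.aeval (U * diagonal l * Uᵀ) p = U * diagonal (fun i => p.eval (l i)) * Uᵀ := by
  have hpow : ∀ k : ℕ, (U * diagonal l * Uᵀ) ^ k = U * diagonal (fun i => l i ^ k) * Uᵀ := by
    intro k
    induction k with
    | zero => simp [hU]
    | succ k ih =>
      rw [pow_succ, ih, mul_diagonal_mul_transpose_mul hU']
      simp_rw [pow_succ]
  induction p using Polynomial.induction_on' with
  | add p q hp hq =>
    rw [map_add, hp, hq, ← Matrix.add_mul, ← Matrix.mul_add, diagonal_add]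
    simp_rw [Polynomial.eval_add]
  | monomial k c =>
    rw [Polynomial.aeval_monomial, hpow, ← Algebra.smul_def]
    simp_rw [Polynomial.eval_monomial]
    rw [show (fun i => c * l i ^ k) = c • fun i => l i ^ k from rfl, diagonal_smul,
      Matrix.mul_smul, Matrix.smul_mul]

/-- The rows of `U` are unit vectors, so the arithmetic-geometric mean inequality bounds the sum of
products by one. -/
theorem abs_mul_diagonal_mul_transpose_apply_le {U : Matrix n n ℝ} (hU : U * Uᵀ = 1) {v : n → ℝ}
    {c : ℝ} (hv : ∀ i, |v i| ≤ c) (i j : n) : |(U * diagonal v * Uᵀ) i j| ≤ c := by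
  have hrow : ∀ i, ∑ k, U i k ^ 2 = 1 := by
    intro i
    have := congrFun (congrFun hU i) i
    simp only [Matrix.mul_apply, Matrix.transpose_apply, Matrix.one_apply_eq] at this
    simpa [sq] using this
  rw [Matrix.mul_apply]
  simp only [Matrix.mul_diagonal, Matrix.transpose_apply]
  calc |∑ k, U i k * v k * U j k| ≤ ∑ k, |U i k * v k * U j k| := Finset.abs_sum_le_sum_abs _ _
    _ ≤ ∑ k, c * ((U i k ^ 2 + U j k ^ 2) / 2) := by
        refine Finset.sum_le_sum fun k _ => ?_
        rw [mul_right_comm, abs_mul, mul_comm]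
        refine mul_le_mul (hv k) ?_ (abs_nonneg _) ((abs_nonneg _).trans (hv k))
        rw [abs_mul]
        nlinarith [sq_nonneg (|U i k| - |U j k|), sq_abs (U i k), sq_abs (U j k)]
    _ = c := by
        rw [← Finset.mul_sum, ← Finset.sum_div, Finset.sum_add_distrib, hrow, hrow]
        ring

end Spectral

/-! #### Chebyshev polynomials -/

/-- This is `T_m (cosh u) = cosh (m u)` at `u = log r`. -/
theorem chebyshev_eval_half_add_inv {r : ℝ} (hr : 0 < r) (m : ℕ) :
    (Polynomial.Chebyshev.T ℝ m).eval ((r + r⁻¹) / 2) = (r ^ m + (r ^ m)⁻¹) / 2 := by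
  rw [← Real.cosh_log hr, Polynomial.Chebyshev.T_real_cosh, ← Real.cosh_log (pow_pos hr m),
    Real.log_pow]
  simp

/-- The rate of convergence `(√z - 1) / (√z + 1)` of the Chebyshev iteration for the condition
number `z`. -/
noncomputable def chebyshevRate (z : ℝ) : ℝ := (√z - 1) / (√z + 1)

theorem chebyshevRate_pos {z : ℝ} (hz : 1 < z) : 0 < chebyshevRate z := by
  have : 1 < √z := by rw [Real.lt_sqrt] <;> norm_num; exact hz
  exact div_pos (by linarith) (by linarith)

theorem chebyshevRate_lt_one {z : ℝ} : chebyshevRate z < 1 := by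
  have : 0 ≤ √z := Real.sqrt_nonneg z
  rw [chebyshevRate, div_lt_one (by linarith)]
  linarith

/-- The right-hand side is the image of the origin under the affine map that takes `[a, z a]` to
`[-1, 1]`; in this form the Chebyshev polynomial can be evaluated there. -/
theorem half_chebyshevRate_add_inv {z : ℝ} (hz : 1 < z) :
    (chebyshevRate z + (chebyshevRate z)⁻¹) / 2 = (z + 1) / (z - 1) := by
  have h : 1 < √z := by rw [Real.lt_sqrt] <;> norm_num; exact hz
  have h2 : √z ^ 2 = z := Real.sq_sqrt (by linarith)
  have h3 : √z - 1 ≠ 0 := by linarith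
  have h4 : √z + 1 ≠ 0 := by linarith
  have h5 : z - 1 ≠ 0 := by linarith
  rw [chebyshevRate, inv_div]
  field_simp
  rw [← sub_eq_zero]
  ring_nf
  rw [h2]
  ring

/-- Polynomials with value one at the origin that are small on `[a, z a]`. -/
theorem exists_polynomial_eval_zero_eq_one {a z : ℝ} (ha : 0 < a) (hz : 1 < z) (m : ℕ) :
    ∃ q : Polynomial ℝ, q.natDegree ≤ m ∧ q.coeff 0 = 1 ∧
      ∀ t, a ≤ t → t ≤ z * a → |q.eval t| ≤ 2 * chebyshevRate z ^ m := by
  set ρ := chebyshevRate z with hρ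
  have hρ0 : 0 < ρ := chebyshevRate_pos hz
  have hz1 : 0 < (z - 1) * a := mul_pos (by linarith) ha
  set w := (z + 1) / (z - 1) with hw
  set t₀ := (Polynomial.Chebyshev.T ℝ m).eval w with ht₀
  have ht₀' : t₀ = (ρ ^ m + (ρ ^ m)⁻¹) / 2 := by
    rw [ht₀, hw, ← half_chebyshevRate_add_inv hz, chebyshev_eval_half_add_inv hρ0]
  have hρm : 0 < ρ ^ m := pow_pos hρ0 m
  have hpos : 0 < t₀ := by rw [ht₀']; positivity
  -- The affine map with `a ↦ 1`, `z a ↦ -1` and `0 ↦ w`.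
  set g : Polynomial ℝ := Polynomial.C w - Polynomial.C (2 / ((z - 1) * a)) * Polynomial.X with hg
  have hgdeg : g.natDegree ≤ 1 := by
    rw [hg]
    compute_degree
  refine ⟨Polynomial.C t₀⁻¹ * (Polynomial.Chebyshev.T ℝ m).comp g, ?_, ?_, fun t hat htb => ?_⟩
  · refine (Polynomial.natDegree_C_mul_le _ _).trans ?_
    refine Polynomial.natDegree_comp_le.trans ?_
    rw [Polynomial.Chebyshev.natDegree_T, Int.natAbs_natCast]
    exact (Nat.mul_le_mul_left m hgdeg).trans (Nat.mul_one m).le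
  · rw [Polynomial.coeff_zero_eq_eval_zero]
    simp only [Polynomial.eval_mul, Polynomial.eval_C, Polynomial.eval_comp, hg,
      Polynomial.eval_sub, Polynomial.eval_X, mul_zero, sub_zero]
    exact inv_mul_cancel₀ hpos.ne'
  · have hgt : |g.eval t| ≤ 1 := by
      have : g.eval t = ((z + 1) * a - 2 * t) / ((z - 1) * a) := by
        have h5 : z - 1 ≠ 0 := by linarith
        simp only [hg, hw, Polynomial.eval_sub, Polynomial.eval_mul, Polynomial.eval_C,
          Polynomial.eval_X]
        field_simp
      rw [this, abs_div, abs_of_pos hz1, div_le_one hz1, abs_le]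
      constructor <;> linarith
    have h1 := Polynomial.Chebyshev.abs_eval_T_real_le_one m hgt
    rw [Polynomial.eval_mul, Polynomial.eval_C, Polynomial.eval_comp, abs_mul,
      abs_of_pos (inv_pos.mpr hpos)]
    have h2 : t₀⁻¹ ≤ 2 * ρ ^ m := by
      rw [inv_le_comm₀ hpos (by positivity), ht₀', mul_inv]
      linarith
    calc t₀⁻¹ * |(Polynomial.Chebyshev.T ℝ m).eval (g.eval t)| ≤ t₀⁻¹ * 1 := by gcongr
      _ ≤ _ := by linarith

/-! ### Polynomials in banded matrices and decay of the inverse -/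

section Banded

variable {n : Type*} [Fintype n] [DecidableEq n] {X : Type*} [PseudoMetricSpace X]

/-- A nonzero entry would need a path of `k` steps, each shorter than `δ`. For `k = 0` the distance
condition is empty, hence the assumption `i ≠ j`. -/
theorem pow_apply_eq_zero_of_banded {A : Matrix n n ℝ} {x : n → X} {δ : ℝ} (hδ : 0 ≤ δ)
    (hband : ∀ i j, δ ≤ dist (x i) (x j) → A i j = 0) (k : ℕ) {i j : n} (hij : i ≠ j)
    (h : k * δ ≤ dist (x i) (x j)) : (A ^ k) i j = 0 := by
  induction k generalizing j with
  | zero => simp [hij]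
  | succ k ih =>
    rw [pow_succ, Matrix.mul_apply]
    refine Finset.sum_eq_zero fun l _ => ?_
    by_cases hl : δ ≤ dist (x l) (x j)
    · rw [hband l j hl, mul_zero]
    · push Not at hl
      have h1 := dist_triangle (x i) (x l) (x j)
      push_cast at h
      have h2 : k * δ < dist (x i) (x l) := by linarith
      have h3 : i ≠ l := by
        rintro rfl
        rw [dist_self] at h2
        have : 0 ≤ (k : ℝ) * δ := by positivity
        linarith
      rw [ih h3 h2.le, zero_mul]

theorem aeval_apply_eq_zero_of_banded {A : Matrix n n ℝ} {x : n → X} {δ : ℝ} (hδ : 0 ≤ δ)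
    (hband : ∀ i j, δ ≤ dist (x i) (x j) → A i j = 0) {m : ℕ} {p : Polynomial ℝ}
    (hp : p.natDegree ≤ m) {i j : n} (hij : i ≠ j) (h : m * δ ≤ dist (x i) (x j)) :
    (Polynomial.aeval A p) i j = 0 := by
  rw [Polynomial.aeval_eq_sum_range, Matrix.sum_apply]
  refine Finset.sum_eq_zero fun k hk => ?_
  rw [Matrix.smul_apply, pow_apply_eq_zero_of_banded hδ hband k hij, smul_zero]
  refine le_trans ?_ h
  have : k ≤ m := by rw [Finset.mem_range] at hk; omega
  gcongr

/-- Exponential decay of the inverse of a banded positive definite matrix of condition number at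
most `z`. -/
theorem abs_inv_apply_le {A : Matrix n n ℝ} (hA : A.IsHermitian) {a z : ℝ} (ha : 0 < a)
    (hz : 1 < z) (hlow : ∀ v : n → ℝ, a * ∑ i, v i ^ 2 ≤ v ⬝ᵥ A *ᵥ v)
    (hup : ∀ v : n → ℝ, v ⬝ᵥ A *ᵥ v ≤ z * a * ∑ i, v i ^ 2) {x : n → X} {δ : ℝ} (hδ : 0 < δ)
    (hband : ∀ i j, δ ≤ dist (x i) (x j) → A i j = 0) (i j : n) :
    |A⁻¹ i j| ≤ 2 / a * chebyshevRate z ^ (dist (x i) (x j) / δ) := by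
  obtain ⟨U, l, hU, hU', hAU, hl⟩ := exists_orthogonal_diagonalization hA hlow hup
  have hl0 : ∀ i, 0 < l i := fun i => ha.trans_le (hl i).1
  have hρ0 := chebyshevRate_pos hz
  have hinv : A⁻¹ = U * diagonal (fun i => (l i)⁻¹) * Uᵀ := by
    refine Matrix.inv_eq_right_inv ?_
    rw [hAU, mul_diagonal_mul_transpose_mul hU']
    simp_rw [fun i => mul_inv_cancel₀ (hl0 i).ne']
    rw [diagonal_one, Matrix.mul_one, hU]
  have hlinv : ∀ i, (l i)⁻¹ ≤ a⁻¹ := fun i => inv_anti₀ ha (hl i).1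
  rcases eq_or_ne i j with rfl | hij
  · rw [dist_self, zero_div, Real.rpow_zero, mul_one, hinv]
    refine abs_mul_diagonal_mul_transpose_apply_le hU (fun k => ?_) i i
    rw [abs_of_pos (inv_pos.mpr (hl0 k))]
    refine (hlinv k).trans ?_
    rw [div_eq_mul_inv]
    have : 0 < a⁻¹ := inv_pos.mpr ha
    linarith
  · set m := ⌊dist (x i) (x j) / δ⌋₊ with hm
    have hmle : (m : ℝ) ≤ dist (x i) (x j) / δ := Nat.floor_le (by positivity)
    have hlt : dist (x i) (x j) / δ < (m + 1 : ℕ) := by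
      push_cast; exact Nat.lt_floor_add_one _
    -- Degree `m + 1` is affordable because only `q.divX`, of degree at most `m`, has to vanish at
    -- the entry `(i, j)`. The additional power of the rate pays for rounding down in `m`.
    obtain ⟨q, hqdeg, hq0, hq⟩ := exists_polynomial_eval_zero_eq_one ha hz (m + 1)
    have hqeq := Polynomial.X_mul_divX_add q
    have hpdeg : q.divX.natDegree ≤ m := by
      rw [Polynomial.natDegree_divX_eq_natDegree_tsub_one]; omega
    have hzero := aeval_apply_eq_zero_of_banded hδ.le hband hpdeg hij
      (by rwa [le_div_iff₀ hδ] at hmle)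
    -- Since `q = X * q.divX + 1`, the left-hand side is `A⁻¹ * q(A)`, whose eigenvalues are
    -- uniformly small.
    have hdiff : A⁻¹ + Polynomial.aeval A q.divX =
        U * diagonal (fun i => (l i)⁻¹ * q.eval (l i)) * Uᵀ := by
      rw [hinv, hAU, aeval_mul_diagonal_mul_transpose hU hU', ← Matrix.add_mul, ← Matrix.mul_add,
        diagonal_add]
      congr 3
      ext k
      have hk := (hl0 k).ne'
      conv_rhs => rw [← hqeq, hq0]
      simp only [Polynomial.eval_add, Polynomial.eval_mul, Polynomial.eval_X, Polynomial.eval_C]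
      field_simp
      ring
    have hent : A⁻¹ i j = (U * diagonal (fun i => (l i)⁻¹ * q.eval (l i)) * Uᵀ) i j := by
      rw [← hdiff, Matrix.add_apply, hzero, add_zero]
    rw [hent]
    have h1 : 2 / a * chebyshevRate z ^ (m + 1) ≤
        2 / a * chebyshevRate z ^ (dist (x i) (x j) / δ) := by
      rw [← Real.rpow_natCast]
      gcongr 2 / a * ?_
      exact Real.rpow_le_rpow_of_exponent_ge hρ0 chebyshevRate_lt_one.le hlt.le
    refine le_trans (abs_mul_diagonal_mul_transpose_apply_le hU (fun k => ?_) i j) h1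
    rw [abs_mul, abs_of_pos (inv_pos.mpr (hl0 k))]
    calc (l k)⁻¹ * |q.eval (l k)| ≤ a⁻¹ * (2 * chebyshevRate z ^ (m + 1)) := by
          gcongr
          · exact (hl k).1
          · exact hq _ (hl k).1 (hl k).2
      _ = _ := by ring

end Banded

end Multiscale

namespace Multiscale

/-! ### Sums over shells -/

theorem summable_shell (d n : ℕ) {θ : ℝ} (hθ : 0 < θ) :
    Summable fun m : ℕ => ((m : ℝ) + n + 2) ^ d * Real.exp (-θ * (m + n)) := by
  have h := Real.summable_pow_mul_exp_neg_nat_mul d hθ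
  have h1 := (summable_nat_add_iff (n + 2)).mpr h
  refine (h1.mul_left (Real.exp (2 * θ))).congr fun m => ?_
  push_cast
  rw [mul_left_comm, ← Real.exp_add]
  congr 2 <;> ring

theorem sum_exp_neg_dist_le {d : ℕ} {ι : Type*} (s : Finset ι)
    (x : ι → EuclideanSpace ℝ (Fin d)) (y : EuclideanSpace ℝ (Fin d)) {q θ : ℝ} (hq : 0 < q)
    (hθ : 0 < θ) (hsep : ∀ i ∈ s, ∀ j ∈ s, i ≠ j → 2 * q ≤ ‖x i - x j‖) (n : ℕ)
    (hfar : ∀ i ∈ s, n * q ≤ ‖x i - y‖) :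
    ∑ i ∈ s, Real.exp (-θ * (‖x i - y‖ / q)) ≤
      ∑' m : ℕ, ((m : ℝ) + n + 2) ^ d * Real.exp (-θ * (m + n)) := by
  -- The index of the shell of width `q`, counted from the first shell allowed by `hfar`; the
  -- truncated subtraction is exact there.
  set k : ι → ℕ := fun i => ⌊‖x i - y‖ / q⌋₊ - n with hk
  have hkn : ∀ i ∈ s, k i + n = ⌊‖x i - y‖ / q⌋₊ := by
    intro i hi
    refine Nat.sub_add_cancel (Nat.le_floor ?_)
    rw [le_div_iff₀ hq]
    exact hfar i hi
  calc ∑ i ∈ s, Real.exp (-θ * (‖x i - y‖ / q))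
      ≤ ∑ i ∈ s, Real.exp (-θ * ((k i : ℝ) + n)) := by
        refine Finset.sum_le_sum fun i hi => Real.exp_le_exp.mpr ?_
        have h1 : ((k i : ℝ) + n) = (⌊‖x i - y‖ / q⌋₊ : ℝ) := by exact_mod_cast hkn i hi
        rw [h1]
        have h2 : (⌊‖x i - y‖ / q⌋₊ : ℝ) ≤ ‖x i - y‖ / q := Nat.floor_le (by positivity)
        nlinarith
    _ = ∑ m ∈ s.image k, ((s.filter fun i => k i = m).card : ℝ) *
          Real.exp (-θ * ((m : ℝ) + n)) := by
        rw [Finset.sum_comp (fun m : ℕ => Real.exp (-θ * ((m : ℝ) + n))) k]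
        simp only [nsmul_eq_mul]
    _ ≤ ∑ m ∈ s.image k, ((m : ℝ) + n + 2) ^ d * Real.exp (-θ * (m + n)) := by
        refine Finset.sum_le_sum fun m _ => ?_
        gcongr
        -- The points of shell `m` lie within `(m + n + 1) q` of `y`, and packing adds one more to
        -- the base.
        have h := card_le_of_separated (s.filter fun i => k i = m) x y hq
          (r := ((m : ℝ) + n + 1) * q) (by positivity)
          (fun i hi j hj => hsep i (Finset.mem_filter.mp hi).1 j (Finset.mem_filter.mp hj).1)
          (fun i hi => by
            obtain ⟨hi, him⟩ := Finset.mem_filter.mp hi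
            have h1 := Nat.lt_floor_add_one (‖x i - y‖ / q)
            rw [← hkn i hi, him, div_lt_iff₀ hq] at h1
            push_cast at h1
            exact h1.le)
        rw [mul_div_cancel_right₀ _ hq.ne'] at h
        exact h.trans (le_of_eq (by congr 1; ring))
    _ ≤ _ := (summable_shell d n hθ).sum_le_tsum _ fun m _ => by positivity

/-- The sum over all shells is controlled by the sum `C_Σ`. -/
theorem sum_exp_neg_dist_le_tsum {d : ℕ} {ι : Type*} (s : Finset ι)
    (x : ι → EuclideanSpace ℝ (Fin d)) (y : EuclideanSpace ℝ (Fin d)) {q θ : ℝ} (hq : 0 < q)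
    (hθ : 0 < θ) (hsep : ∀ i ∈ s, ∀ j ∈ s, i ≠ j → 2 * q ≤ ‖x i - x j‖) :
    ∑ i ∈ s, Real.exp (-θ * (‖x i - y‖ / q)) ≤
      ∑' m : ℕ, ((m : ℝ) + 2) ^ d * Real.exp (-θ * m) := by
  simpa using sum_exp_neg_dist_le s x y hq hθ hsep 0 (fun i _ => by simp)

/-- The sum over the points of distance at least `T q`. -/
theorem sum_exp_neg_dist_le_of_far {d : ℕ} {ι : Type*} (s : Finset ι)
    (x : ι → EuclideanSpace ℝ (Fin d)) (y : EuclideanSpace ℝ (Fin d)) {q θ T : ℝ} (hq : 0 < q)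
    (hθ : 0 < θ) (hT : 0 < T) (hTθ : T ^ d ≤ Real.exp (θ / 2 * T))
    (hsep : ∀ i ∈ s, ∀ j ∈ s, i ≠ j → 2 * q ≤ ‖x i - x j‖)
    (hfar : ∀ i ∈ s, T * q ≤ ‖x i - y‖) :
    ∑ i ∈ s, Real.exp (-θ * (‖x i - y‖ / q)) ≤
      Real.exp θ * Real.exp (-(θ / 2 * T)) *
        ∑' m : ℕ, ((m : ℝ) + 2) ^ d * Real.exp (-θ * m) := by
  have hsum : Summable fun m : ℕ => ((m : ℝ) + 2) ^ d * Real.exp (-θ * m) := by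
    simpa using summable_shell d 0 hθ
  have hnn : 0 ≤ ∑' m : ℕ, ((m : ℝ) + 2) ^ d * Real.exp (-θ * m) :=
    tsum_nonneg fun m => by positivity
  rcases lt_or_ge T 2 with hT2 | hT2
  -- For `T < 2` the factor `exp (θ - θ T / 2)` is at least one, and the full sum suffices.
  · refine (sum_exp_neg_dist_le_tsum s x y hq hθ hsep).trans ?_
    rw [← Real.exp_add]
    refine le_mul_of_one_le_left hnn (Real.one_le_exp ?_)
    nlinarith
  · have hfloor : (⌊T⌋₊ : ℝ) ≤ T := Nat.floor_le hT.le
    have hfloor' : T < ⌊T⌋₊ + 1 := Nat.lt_floor_add_one T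
    refine (sum_exp_neg_dist_le s x y hq hθ hsep ⌊T⌋₊ fun i hi => le_trans ?_ (hfar i hi)).trans ?_
    · gcongr
    · rw [← tsum_mul_left]
      refine (summable_shell d ⌊T⌋₊ hθ).tsum_le_tsum (fun m => ?_) (hsum.mul_left _)
      -- This needs `T ≥ 2`. It separates the polynomial factor into `T ^ d`, which half of the
      -- exponential decay in `T` absorbs, and the summand of `C_Σ`. The factor `exp θ` pays for `T
      -- - 1 < ⌊T⌋₊`.
      have h1 : ((m : ℝ) + ⌊T⌋₊ + 2) ≤ T * (m + 2) := by
        have : (0 : ℝ) ≤ m := by positivity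
        nlinarith
      calc ((m : ℝ) + ⌊T⌋₊ + 2) ^ d * Real.exp (-θ * (m + ⌊T⌋₊))
          ≤ (T * (m + 2)) ^ d * Real.exp (θ + -(θ * T) + -θ * m) := by
            gcongr
            nlinarith
        _ = T ^ d * ((m + 2) ^ d * Real.exp (θ + -(θ * T) + -θ * m)) := by rw [mul_pow]; ring
        _ ≤ Real.exp (θ / 2 * T) * ((m + 2) ^ d * Real.exp (θ + -(θ * T) + -θ * m)) := by gcongr
        _ = _ := by
            rw [mul_left_comm, ← Real.exp_add, mul_left_comm, ← Real.exp_add, ← Real.exp_add]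
            congr 2; ring

/-! ### Estimates for the composed constants -/

section Constants

variable {d : ℕ} {Φ : EuclideanSpace ℝ (Fin d) → ℝ} {τ cΦ CΦ cq ν : ℝ}

theorem three_mul_le_constK (hΦ : IsKernel Φ τ cΦ CΦ) (hd : 1 ≤ d) :
    3 * (1 / 3) ^ d ≤ constK d τ cΦ (Φ 0) cq ν := by
  have h := hΦ.three_mul_le hd
  have h1 : (1 : ℝ) ≤ (1 + 4 * constM d ^ 2 * ν ^ 2 * cq ^ 2) ^ τ :=
    Real.one_le_rpow (le_add_of_nonneg_right (by positivity)) hΦ.tau_pos.le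
  unfold constK
  have h0 : (0 : ℝ) ≤ 3 * (1 / 3) ^ d := by positivity
  nlinarith

theorem constK_pos (hΦ : IsKernel Φ τ cΦ CΦ) (hd : 1 ≤ d) : 0 < constK d τ cΦ (Φ 0) cq ν :=
  lt_of_lt_of_le (by positivity) (three_mul_le_constK hΦ hd)

theorem four_le_constZ (hΦ : IsKernel Φ τ cΦ CΦ) (hd : 1 ≤ d) :
    4 ≤ constZ d τ cΦ (Φ 0) cq ν := by
  unfold constZ
  have h : (4 : ℝ) / 3 ≤ (4 / 3) ^ d := le_self_pow₀ (by norm_num) (by omega)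
  calc (4 : ℝ) ≤ 3 * (4 / 3) ^ d := by linarith
    _ = 4 ^ d * (3 * (1 / 3) ^ d) := by
        rw [show (4 : ℝ) / 3 = 4 * (1 / 3) by norm_num, mul_pow]; ring
    _ ≤ _ := by gcongr; exact three_mul_le_constK hΦ hd

theorem one_lt_constZ (hΦ : IsKernel Φ τ cΦ CΦ) (hd : 1 ≤ d) :
    1 < constZ d τ cΦ (Φ 0) cq ν := by
  linarith [four_le_constZ hΦ hd (cq := cq) (ν := ν)]

theorem third_le_chebyshevRate (hΦ : IsKernel Φ τ cΦ CΦ) (hd : 1 ≤ d) :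
    1 / 3 ≤ chebyshevRate (constZ d τ cΦ (Φ 0) cq ν) := by
  have h : 2 ≤ √(constZ d τ cΦ (Φ 0) cq ν) := by
    apply Real.le_sqrt_of_sq_le
    linarith [four_le_constZ hΦ hd (cq := cq) (ν := ν)]
  rw [chebyshevRate, div_le_div_iff₀ (by norm_num) (by linarith)]
  linarith

theorem one_le_sqrt_dim (hd : 1 ≤ d) : 1 ≤ √(d : ℝ) := by
  rw [Real.one_le_sqrt]
  exact_mod_cast hd

theorem log_chebyshevRate (hd : 1 ≤ d) :
    Real.log (chebyshevRate (constZ d τ cΦ (Φ 0) cq ν)) =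
      -(2 * √(d : ℝ) * max (cq * ν) 4 * constTheta d τ cΦ (Φ 0) cq ν) := by
  have h1 := one_le_sqrt_dim hd
  have h2 : (4 : ℝ) ≤ max (cq * ν) 4 := le_max_right _ _
  unfold constTheta chebyshevRate
  have h3 : √(d : ℝ) ≠ 0 := by linarith
  have h4 : max (cq * ν) 4 ≠ 0 := by linarith
  field_simp

theorem constTheta_pos (hΦ : IsKernel Φ τ cΦ CΦ) (hd : 1 ≤ d) :
    0 < constTheta d τ cΦ (Φ 0) cq ν := by
  have h1 := one_le_sqrt_dim hd
  have h2 : (4 : ℝ) ≤ max (cq * ν) 4 := le_max_right _ _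
  have hlog := log_chebyshevRate (Φ := Φ) (τ := τ) (cΦ := cΦ) (cq := cq) (ν := ν) hd
  have hneg := Real.log_neg (chebyshevRate_pos (one_lt_constZ hΦ hd (cq := cq) (ν := ν)))
    chebyshevRate_lt_one
  rw [hlog, neg_lt_zero] at hneg
  exact pos_of_mul_pos_right hneg (by positivity)

/-- The `4` in `max (cq * ν) 4` keeps `θ` small even when `cq * ν` is small, and `z ≥ 4` keeps the
rate above one third. -/
theorem exp_four_mul_constTheta_le (hΦ : IsKernel Φ τ cΦ CΦ) (hd : 1 ≤ d) :
    Real.exp (4 * constTheta d τ cΦ (Φ 0) cq ν) ≤ 3 := by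
  have h1 := one_le_sqrt_dim hd
  have h2 : (4 : ℝ) ≤ max (cq * ν) 4 := le_max_right _ _
  have hθ := constTheta_pos hΦ hd (cq := cq) (ν := ν)
  have hlog := log_chebyshevRate (Φ := Φ) (τ := τ) (cΦ := cΦ) (cq := cq) (ν := ν) hd
  have hρ := third_le_chebyshevRate hΦ hd (cq := cq) (ν := ν)
  have hρ0 := chebyshevRate_pos (one_lt_constZ hΦ hd (cq := cq) (ν := ν))
  have h3 : 4 * constTheta d τ cΦ (Φ 0) cq ν ≤
      -Real.log (chebyshevRate (constZ d τ cΦ (Φ 0) cq ν)) := by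
    rw [hlog, neg_neg]
    have : 4 ≤ 2 * √(d : ℝ) * max (cq * ν) 4 := by nlinarith
    gcongr
  calc Real.exp (4 * constTheta d τ cΦ (Φ 0) cq ν)
      ≤ Real.exp (-Real.log (chebyshevRate (constZ d τ cΦ (Φ 0) cq ν))) := Real.exp_le_exp.mpr h3
    _ = (chebyshevRate (constZ d τ cΦ (Φ 0) cq ν))⁻¹ := by rw [Real.exp_neg, Real.exp_log hρ0]
    _ ≤ (1 / 3 : ℝ)⁻¹ := inv_anti₀ (by norm_num) hρ
    _ = 3 := by norm_num

theorem chebyshevRate_rpow (hΦ : IsKernel Φ τ cΦ CΦ) (hd : 1 ≤ d) (t : ℝ) :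
    chebyshevRate (constZ d τ cΦ (Φ 0) cq ν) ^ t =
      Real.exp (-(2 * √(d : ℝ) * max (cq * ν) 4 * constTheta d τ cΦ (Φ 0) cq ν) * t) := by
  rw [Real.rpow_def_of_pos (chebyshevRate_pos (one_lt_constZ hΦ hd)), log_chebyshevRate hd]

/-- The single summand `m = 4` of `C_Σ` is at least `6 ^ d / 3`, which the lower bound `3 * (1 / 3)
^ d` of `K` turns into `2 ^ d`. -/
theorem two_pow_le_constK_mul_constSigma (hΦ : IsKernel Φ τ cΦ CΦ) (hd : 1 ≤ d) :
    2 ^ d ≤ constK d τ cΦ (Φ 0) cq ν * constSigma d τ cΦ (Φ 0) cq ν := by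
  have hθ := constTheta_pos hΦ hd (cq := cq) (ν := ν)
  have hexp := exp_four_mul_constTheta_le hΦ hd (cq := cq) (ν := ν)
  have hsum : Summable fun m : ℕ =>
      ((m : ℝ) + 2) ^ d * Real.exp (-constTheta d τ cΦ (Φ 0) cq ν * m) := by
    simpa using summable_shell d 0 hθ
  have h := hsum.le_tsum 4 fun m _ => by positivity
  have h1 : (6 : ℝ) ^ d * (1 / 3) ≤ constSigma d τ cΦ (Φ 0) cq ν := by
    refine le_trans ?_ h
    have h2 : (1 / 3 : ℝ) ≤ Real.exp (-constTheta d τ cΦ (Φ 0) cq ν * (4 : ℕ)) := by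
      rw [neg_mul, Real.exp_neg, one_div]
      refine inv_anti₀ (Real.exp_pos _) ?_
      rwa [mul_comm] at hexp
    have h3 : (((4 : ℕ) : ℝ) + 2) = 6 := by norm_num
    rw [h3]
    gcongr
  calc (2 : ℝ) ^ d = 3 * (1 / 3) ^ d * (6 ^ d * (1 / 3)) := by
        rw [show (6 : ℝ) = 2 * 3 by norm_num, mul_pow, one_div, inv_pow]; field_simp
    _ ≤ _ := by
        have := constK_pos hΦ hd (cq := cq) (ν := ν)
        gcongr
        exact three_mul_le_constK hΦ hd

theorem constSigma_nonneg : 0 ≤ constSigma d τ cΦ (Φ 0) cq ν :=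
  tsum_nonneg fun m => by positivity

/-- The row estimate produces the left-hand side; the factor `e^(2θ√d)` in `C` is at least one. -/
theorem le_constC (hΦ : IsKernel Φ τ cΦ CΦ) (hd : 1 ≤ d) (hw : 0 ≤ ν * cq) :
    2 * constK d τ cΦ (Φ 0) cq ν * Real.exp (cq * ν * constTheta d τ cΦ (Φ 0) cq ν) *
      (1 + ν * cq) ^ d ≤ constC d τ cΦ (Φ 0) cq ν := by
  have hK := constK_pos hΦ hd (cq := cq) (ν := ν)
  have hθ := constTheta_pos hΦ hd (cq := cq) (ν := ν)
  unfold constC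
  have h1 : 1 ≤ Real.exp (2 * constTheta d τ cΦ (Φ 0) cq ν * √(d : ℝ)) :=
    Real.one_le_exp (by positivity)
  refine mul_le_mul_of_nonneg_right (mul_le_mul_of_nonneg_right
    (le_mul_of_one_le_right (by positivity) h1) (by positivity)) (by positivity)

end Constants

end Multiscale

namespace Multiscale

/-! ### Kernel matrices on one level -/

/-- The kernel matrix of a point set. -/
noncomputable def kernelMatrix {d : ℕ} {ι : Type*} (Φ : EuclideanSpace ℝ (Fin d) → ℝ) (δ : ℝ)
    (x : ι → EuclideanSpace ℝ (Fin d)) : Matrix ι ι ℝ :=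
  Matrix.of fun i j => scaledKernel Φ δ (x i - x j)

/-- The row of coefficients that belongs to the point `y`. -/
noncomputable def kernelRow {d : ℕ} {ι : Type*} [Fintype ι] [DecidableEq ι]
    (Φ : EuclideanSpace ℝ (Fin d) → ℝ) (δ : ℝ) (x : ι → EuclideanSpace ℝ (Fin d))
    (y : EuclideanSpace ℝ (Fin d)) (j : ι) : ℝ :=
  ∑ m, scaledKernel Φ δ (y - x m) * (kernelMatrix Φ δ x)⁻¹ m j

/-! ### Bounds for the quadratic form of a kernel matrix -/

section ScaledKernel

variable {d : ℕ} {Φ : EuclideanSpace ℝ (Fin d) → ℝ} {τ cΦ CΦ δ : ℝ}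

theorem scaledKernel_eq_zero (hΦ : IsKernel Φ τ cΦ CΦ) (hδ : 0 < δ)
    {x : EuclideanSpace ℝ (Fin d)} (hx : δ ≤ ‖x‖) : scaledKernel Φ δ x = 0 := by
  rw [scaledKernel, hΦ.eq_zero, mul_zero]
  rw [norm_smul, norm_inv, Real.norm_of_nonneg hδ.le, ← div_eq_inv_mul, le_div_iff₀ hδ]
  linarith

theorem abs_scaledKernel_le (hΦ : IsKernel Φ τ cΦ CΦ) (hδ : 0 < δ)
    (x : EuclideanSpace ℝ (Fin d)) : |scaledKernel Φ δ x| ≤ (δ ^ d)⁻¹ * Φ 0 := by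
  rw [scaledKernel, abs_mul, abs_of_pos (by positivity)]
  gcongr
  exact hΦ.abs_le _

theorem kernelMatrix_isHermitian {ι : Type*} (hΦ : IsKernel Φ τ cΦ CΦ)
    (x : ι → EuclideanSpace ℝ (Fin d)) : (kernelMatrix Φ δ x).IsHermitian := by
  refine Matrix.IsHermitian.ext fun i j => ?_
  rw [star_trivial, kernelMatrix, Matrix.of_apply, Matrix.of_apply, scaledKernel, scaledKernel,
    ← hΦ.even, ← smul_neg, neg_sub]

variable {ι : Type*} [Fintype ι] {x : ι → EuclideanSpace ℝ (Fin d)} {q : ℝ}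

/-- Only points within `δ` of `y` contribute, and packing counts them. -/
theorem sum_abs_scaledKernel_le (hΦ : IsKernel Φ τ cΦ CΦ) (hδ : 0 < δ) (hq : 0 < q)
    (hsep : ∀ i j, i ≠ j → 2 * q ≤ ‖x i - x j‖) (y : EuclideanSpace ℝ (Fin d)) :
    ∑ m, |scaledKernel Φ δ (y - x m)| ≤ (1 + δ / q) ^ d * ((δ ^ d)⁻¹ * Φ 0) := by
  classical
  have h0 : 0 ≤ (δ ^ d)⁻¹ * Φ 0 := (abs_nonneg _).trans (abs_scaledKernel_le hΦ hδ 0)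
  calc ∑ m, |scaledKernel Φ δ (y - x m)|
      = ∑ m ∈ Finset.univ.filter fun m => ‖x m - y‖ < δ, |scaledKernel Φ δ (y - x m)| := by
        refine (Finset.sum_filter_of_ne fun m _ hm => ?_).symm
        by_contra h
        rw [not_lt, norm_sub_rev] at h
        exact hm (by rw [scaledKernel_eq_zero hΦ hδ h, abs_zero])
    _ ≤ ∑ m ∈ Finset.univ.filter fun m => ‖x m - y‖ < δ, (δ ^ d)⁻¹ * Φ 0 :=
        Finset.sum_le_sum fun m _ => abs_scaledKernel_le hΦ hδ _
    _ = ((Finset.univ.filter fun m => ‖x m - y‖ < δ).card : ℝ) * ((δ ^ d)⁻¹ * Φ 0) := by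
        rw [Finset.sum_const, nsmul_eq_mul]
    _ ≤ _ := by
        gcongr
        exact card_le_of_separated _ x y hq hδ.le (fun i _ j _ => hsep i j)
          fun i hi => (Finset.mem_filter.mp hi).2.le

/-- The Schur test: split `|v i| |v j|` by the arithmetic-geometric mean inequality and use symmetry
to turn column sums into row sums. -/
theorem dotProduct_mulVec_le_of_sum_abs_le {A : Matrix ι ι ℝ} (hA : A.IsHermitian) {c : ℝ}
    (hc : ∀ i, ∑ j, |A i j| ≤ c) (v : ι → ℝ) : v ⬝ᵥ A *ᵥ v ≤ c * ∑ i, v i ^ 2 := by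
  have hsymm : ∀ i j, A j i = A i j := fun i j => by simpa using hA.apply i j
  have h1 : ∑ i, ∑ j, |A i j| * v j ^ 2 = ∑ i, ∑ j, |A i j| * v i ^ 2 := by
    rw [Finset.sum_comm]
    exact Finset.sum_congr rfl fun i _ => Finset.sum_congr rfl fun j _ => by rw [hsymm]
  calc v ⬝ᵥ A *ᵥ v = ∑ i, ∑ j, v i * (A i j * v j) := by
        simp only [dotProduct, mulVec, Finset.mul_sum]
    _ ≤ ∑ i, ∑ j, (|A i j| * v i ^ 2 + |A i j| * v j ^ 2) / 2 := by
        refine Finset.sum_le_sum fun i _ => Finset.sum_le_sum fun j _ => ?_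
        calc v i * (A i j * v j) ≤ |v i * (A i j * v j)| := le_abs_self _
          _ = |A i j| * (|v i| * |v j|) := by rw [abs_mul, abs_mul]; ring
          _ ≤ |A i j| * ((v i ^ 2 + v j ^ 2) / 2) := by
              gcongr
              nlinarith [sq_nonneg (|v i| - |v j|), sq_abs (v i), sq_abs (v j)]
          _ = _ := by ring
    _ = ∑ i, (∑ j, |A i j|) * v i ^ 2 := by
        simp_rw [← Finset.sum_div, Finset.sum_add_distrib, h1, Finset.sum_mul]
        ring
    _ ≤ ∑ i, c * v i ^ 2 := by
        gcongr with i
        exact hc i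
    _ = _ := by rw [Finset.mul_sum]

/-- Rescaling by `δ⁻¹` changes the separation to `q / δ`. The bound `δ / q ≤ w` enters through the
decreasing power `-τ`, while the factor `(δ / (2 * q)) ^ d` is kept exact to cancel against the
upper bound. -/
theorem le_dotProduct_kernelMatrix_mulVec (hΦ : IsKernel Φ τ cΦ CΦ) (hd : 1 ≤ d) (hδ : 0 < δ)
    (hq : 0 < q) (hsep : ∀ i j, i ≠ j → 2 * q ≤ ‖x i - x j‖) {w : ℝ} (hw : δ ≤ w * q)
    (v : ι → ℝ) :
    (δ ^ d)⁻¹ * (constCd d * cΦ * (1 + 4 * constM d ^ 2 * w ^ 2) ^ (-τ)) * (δ / (2 * q)) ^ d *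
      ∑ i, v i ^ 2 ≤ v ⬝ᵥ kernelMatrix Φ δ x *ᵥ v := by
  have hcΦ := hΦ.cΦ_pos
  have hC := constCd_pos d
  have h := hΦ.le_sum_sum hd (r := q / δ) (by positivity) (fun i => δ⁻¹ • x i)
    (fun i j hij => by
      rw [← smul_sub, norm_smul, norm_inv, Real.norm_of_nonneg hδ.le]
      calc 2 * (q / δ) = δ⁻¹ * (2 * q) := by ring
        _ ≤ _ := by gcongr; exact hsep i j hij) v
  have h1 : v ⬝ᵥ kernelMatrix Φ δ x *ᵥ v =
      (δ ^ d)⁻¹ * ∑ i, ∑ j, v i * v j * Φ (δ⁻¹ • x i - δ⁻¹ • x j) := by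
    simp only [dotProduct, mulVec, Finset.mul_sum, kernelMatrix, Matrix.of_apply, scaledKernel,
      smul_sub]
    exact Finset.sum_congr rfl fun i _ => Finset.sum_congr rfl fun j _ => by ring
  rw [h1, mul_assoc, mul_assoc]
  gcongr (δ ^ d)⁻¹ * ?_
  refine le_trans ?_ h
  rw [← mul_assoc]
  have e1 : 1 / (2 * (q / δ)) = δ / (2 * q) := by field_simp
  rw [e1]
  gcongr constCd d * cΦ * ?_ * _ * _
  refine Real.rpow_le_rpow_of_nonpos (by positivity) ?_ (by linarith [hΦ.tau_pos])
  rw [div_pow, div_div_eq_mul_div, mul_div_assoc, ← div_pow]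
  have : δ / q ≤ w := by rwa [div_le_iff₀ hq]
  gcongr

end ScaledKernel

theorem sum_ite_norm_lt_le {d : ℕ} {ι : Type*} {x : ι → EuclideanSpace ℝ (Fin d)}
    {cq ν δ q : ℝ} (hδ : 0 < δ) (hq : 0 < q)
    (hsep : ∀ i j, i ≠ j → 2 * q ≤ ‖x i - x j‖) (hw : δ ≤ ν * cq * q)
    (y : EuclideanSpace ℝ (Fin d)) (s : Finset ι) :
    ∑ j ∈ s, (if ‖x j - y‖ < δ then (1 : ℝ) else 0) ≤ (1 + ν * cq) ^ d := by
  rw [Finset.sum_boole]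
  refine (card_le_of_separated _ x y hq hδ.le (fun i _ j _ => hsep i j)
    fun i hi => (Finset.mem_filter.mp hi).2.le).trans ?_
  have hwq : δ / q ≤ ν * cq := by rwa [div_le_iff₀ hq]
  gcongr

/-! ### Decay and row sums of the coefficient rows -/

section Level

variable {d : ℕ} {Φ : EuclideanSpace ℝ (Fin d) → ℝ} {τ cΦ CΦ cq ν δ q : ℝ}
  {ι : Type*} [Fintype ι] [DecidableEq ι] {x : ι → EuclideanSpace ℝ (Fin d)}

/-- Only points `x m` within `δ` of `y` enter the row, so the decay of the inverse from `x m` to `x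
j` is decay from `y` up to the factor `exp (cq * ν * θ)`. The assumption `2 * q < δ` is what bounds
the condition number by `z`. -/
theorem abs_kernelRow_le_of_lt (hΦ : IsKernel Φ τ cΦ CΦ) (hd : 1 ≤ d) (hδ : 0 < δ) (hq : 0 < q)
    (hsep : ∀ i j, i ≠ j → 2 * q ≤ ‖x i - x j‖) (hw : δ ≤ ν * cq * q) (hqδ : 2 * q < δ)
    (y : EuclideanSpace ℝ (Fin d)) (j : ι) :
    |kernelRow Φ δ x y j| ≤ constC d τ cΦ (Φ 0) cq ν *
      Real.exp (-constTheta d τ cΦ (Φ 0) cq ν * (‖x j - y‖ / q)) := by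
  have hcΦ := hΦ.cΦ_pos
  have hC := constCd_pos d
  have hK := constK_pos hΦ hd (cq := cq) (ν := ν)
  have hθ := constTheta_pos hΦ hd (cq := cq) (ν := ν)
  have hΦ0 := hΦ.apply_zero_pos hd
  have hz := one_lt_constZ hΦ hd (cq := cq) (ν := ν)
  have hwq : δ / q ≤ ν * cq := by rwa [div_le_iff₀ hq]
  have hw0 : 0 < ν * cq := lt_of_lt_of_le (by positivity) hwq
  set θ := constTheta d τ cΦ (Φ 0) cq ν with hθdef
  set K := constK d τ cΦ (Φ 0) cq ν with hKdef
  set B := constCd d * cΦ * (1 + 4 * constM d ^ 2 * (ν * cq) ^ 2) ^ (-τ) with hB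
  have hB0 : 0 < B := by positivity
  have hKB : K * B = Φ 0 := by
    have h1 : (0 : ℝ) < 1 + 4 * constM d ^ 2 * (ν * cq) ^ 2 := by positivity
    have h2 : (1 + 4 * constM d ^ 2 * (ν * cq) ^ 2) ^ τ *
        (1 + 4 * constM d ^ 2 * (ν * cq) ^ 2) ^ (-τ) = 1 := by
      rw [← Real.rpow_add h1, add_neg_cancel, Real.rpow_zero]
    have h3 : 1 + 4 * constM d ^ 2 * ν ^ 2 * cq ^ 2 = 1 + 4 * constM d ^ 2 * (ν * cq) ^ 2 := by
      ring
    rw [hKdef, constK, hB, h3]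
    calc _ = Φ 0 * ((constCd d * cΦ)⁻¹ * (constCd d * cΦ)) *
          ((1 + 4 * constM d ^ 2 * (ν * cq) ^ 2) ^ τ *
        (1 + 4 * constM d ^ 2 * (ν * cq) ^ 2) ^ (-τ)) := by ring
      _ = _ := by rw [h2, inv_mul_cancel₀ (by positivity)]; ring
  set σ := δ / (2 * q) with hσ
  have hσ1 : 1 ≤ σ := by rw [hσ, le_div_iff₀ (by positivity)]; linarith
  set a := (δ ^ d)⁻¹ * B * σ ^ d with ha
  have ha0 : 0 < a := by positivity
  have hherm := kernelMatrix_isHermitian (δ := δ) hΦ x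
  have hinv := abs_inv_apply_le hherm ha0 hz
    (le_dotProduct_kernelMatrix_mulVec hΦ hd hδ hq hsep hw)
    (fun v => by
      refine dotProduct_mulVec_le_of_sum_abs_le hherm (fun i => ?_) v
      refine (sum_abs_scaledKernel_le hΦ hδ hq hsep (x i)).trans ?_
      -- Here `δ / q = 2 σ` and `σ ≥ 1`. This is the origin of `4 ^ d` in `z`, since the power `σ ^
      -- d` cancels against the one in `a`.
      have h1 : 1 + δ / q ≤ 4 * σ := by
        have : δ / q = 2 * σ := by rw [hσ]; field_simp
        rw [this]; linarith
      calc (1 + δ / q) ^ d * ((δ ^ d)⁻¹ * Φ 0) ≤ (4 * σ) ^ d * ((δ ^ d)⁻¹ * Φ 0) := by gcongr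
        _ = constZ d τ cΦ (Φ 0) cq ν * a := by
            rw [constZ, ← hKdef, ha, mul_pow, ← hKB]; ring)
    hδ (x := x) (fun i k h => scaledKernel_eq_zero hΦ hδ (by rwa [dist_eq_norm] at h))
  have hterm : ∀ m, |scaledKernel Φ δ (y - x m) * (kernelMatrix Φ δ x)⁻¹ m j| ≤
      |scaledKernel Φ δ (y - x m)| * (2 / ((δ ^ d)⁻¹ * B) *
        (Real.exp (cq * ν * θ) * Real.exp (-θ * (‖x j - y‖ / q)))) := by
    intro m
    rw [abs_mul]
    rcases le_or_gt δ ‖y - x m‖ with hfar | hnear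
    · rw [scaledKernel_eq_zero hΦ hδ hfar, abs_zero, zero_mul, zero_mul]
    gcongr
    refine (hinv m j).trans ?_
    have h1 : (δ ^ d)⁻¹ * B ≤ a := le_mul_of_one_le_right (by positivity) (one_le_pow₀ hσ1)
    rw [chebyshevRate_rpow hΦ hd, ← Real.exp_add, ← hθdef]
    gcongr 2 / ?_ * Real.exp ?_
    have h2 : ‖x j - y‖ ≤ δ + dist (x m) (x j) := by
      rw [← dist_eq_norm, dist_comm]
      refine (dist_triangle y (x m) (x j)).trans ?_
      rw [dist_eq_norm y]
      linarith
    -- This converts decay per `δ` with the Chebyshev rate into decay per `q` with rate `θ`, as the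
    -- definition of `θ` intends.
    have h3 : δ / q ≤ 2 * √(d : ℝ) * max (cq * ν) 4 := by
      have h4 := one_le_sqrt_dim hd
      have h5 : cq * ν ≤ max (cq * ν) 4 := le_max_left _ _
      nlinarith
    have h6 : dist (x m) (x j) / q ≤ 2 * √(d : ℝ) * max (cq * ν) 4 * (dist (x m) (x j) / δ) := by
      calc dist (x m) (x j) / q = δ / q * (dist (x m) (x j) / δ) := by field_simp
        _ ≤ _ := by gcongr
    have h7 : ‖x j - y‖ / q ≤ ν * cq + dist (x m) (x j) / q := by
      calc ‖x j - y‖ / q ≤ (δ + dist (x m) (x j)) / q := by gcongr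
        _ = δ / q + dist (x m) (x j) / q := add_div _ _ _
        _ ≤ _ := by gcongr
    nlinarith
  calc |kernelRow Φ δ x y j|
      ≤ ∑ m, |scaledKernel Φ δ (y - x m) * (kernelMatrix Φ δ x)⁻¹ m j| :=
        Finset.abs_sum_le_sum_abs _ _
    _ ≤ ∑ m, |scaledKernel Φ δ (y - x m)| * (2 / ((δ ^ d)⁻¹ * B) *
        (Real.exp (cq * ν * θ) * Real.exp (-θ * (‖x j - y‖ / q)))) :=
        Finset.sum_le_sum fun m _ => hterm m
    _ = (∑ m, |scaledKernel Φ δ (y - x m)|) * (2 / ((δ ^ d)⁻¹ * B) *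
        (Real.exp (cq * ν * θ) * Real.exp (-θ * (‖x j - y‖ / q)))) := by rw [Finset.sum_mul]
    _ ≤ ((1 + ν * cq) ^ d * ((δ ^ d)⁻¹ * Φ 0)) * (2 / ((δ ^ d)⁻¹ * B) *
        (Real.exp (cq * ν * θ) * Real.exp (-θ * (‖x j - y‖ / q)))) := by
        gcongr
        refine (sum_abs_scaledKernel_le hΦ hδ hq hsep y).trans ?_
        gcongr
    _ = 2 * K * Real.exp (cq * ν * θ) * (1 + ν * cq) ^ d *
        Real.exp (-θ * (‖x j - y‖ / q)) := by
        rw [← hKB]; field_simp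
    _ ≤ _ := by
        gcongr
        exact le_constC hΦ hd hw0.le

/-- Distinct points are at least a support radius apart, so the kernel matrix is a multiple of the
identity. -/
theorem abs_kernelRow_le_of_le (hΦ : IsKernel Φ τ cΦ CΦ) (hd : 1 ≤ d) (hδ : 0 < δ)
    (hsep : ∀ i j, i ≠ j → 2 * q ≤ ‖x i - x j‖) (hqδ : δ ≤ 2 * q)
    (y : EuclideanSpace ℝ (Fin d)) (j : ι) :
    |kernelRow Φ δ x y j| ≤ if ‖x j - y‖ < δ then 1 else 0 := by
  have hΦ0 := hΦ.apply_zero_pos hd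
  have hA : kernelMatrix Φ δ x = diagonal fun _ => (δ ^ d)⁻¹ * Φ 0 := by
    ext i k
    rw [kernelMatrix, Matrix.of_apply]
    rcases eq_or_ne i k with rfl | hik
    · simp [scaledKernel]
    · rw [diagonal_apply_ne _ hik, scaledKernel_eq_zero hΦ hδ (hqδ.trans (hsep i k hik))]
  have hinv : (kernelMatrix Φ δ x)⁻¹ = diagonal fun _ => ((δ ^ d)⁻¹ * Φ 0)⁻¹ := by
    refine Matrix.inv_eq_right_inv ?_
    rw [hA, diagonal_mul_diagonal]
    have : (δ ^ d)⁻¹ * Φ 0 ≠ 0 := by positivity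
    simp_rw [mul_inv_cancel₀ this]
    exact diagonal_one
  have hrow : kernelRow Φ δ x y j = scaledKernel Φ δ (y - x j) * ((δ ^ d)⁻¹ * Φ 0)⁻¹ := by
    rw [kernelRow, hinv, Finset.sum_eq_single j]
    · rw [diagonal_apply_eq]
    · intro m _ hm
      rw [diagonal_apply_ne _ hm, mul_zero]
    · simp
  rw [hrow]
  split_ifs with h
  · have hpos : 0 < (δ ^ d)⁻¹ * Φ 0 := by positivity
    rw [abs_mul, abs_inv, abs_of_pos hpos, ← div_eq_mul_inv, div_le_one hpos]
    exact abs_scaledKernel_le hΦ hδ _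
  · rw [scaledKernel_eq_zero hΦ hδ (by rw [norm_sub_rev]; exact not_lt.mp h)]
    simp

theorem constC_pos (hΦ : IsKernel Φ τ cΦ CΦ) (hd : 1 ≤ d) (hw : 0 ≤ ν * cq) :
    0 < constC d τ cΦ (Φ 0) cq ν := by
  have hK := constK_pos hΦ hd (cq := cq) (ν := ν)
  exact lt_of_lt_of_le (by positivity) (le_constC hΦ hd hw)

/-- This places the case `δ ≤ 2 * q`, where rows are only counted, under the same constant as the
case of exponential decay. -/
theorem le_constC_mul_constSigma (hΦ : IsKernel Φ τ cΦ CΦ) (hd : 1 ≤ d) (hw : 0 ≤ ν * cq) :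
    2 ^ d * Real.exp (cq * ν * constTheta d τ cΦ (Φ 0) cq ν) * (1 + ν * cq) ^ d ≤
      constC d τ cΦ (Φ 0) cq ν * constSigma d τ cΦ (Φ 0) cq ν := by
  have hS := constSigma_nonneg (Φ := Φ) (d := d) (τ := τ) (cΦ := cΦ) (cq := cq) (ν := ν)
  have h := two_pow_le_constK_mul_constSigma hΦ hd (cq := cq) (ν := ν)
  have h2 : (0 : ℝ) < 2 ^ d := by positivity
  calc _ ≤ (2 * (constK d τ cΦ (Φ 0) cq ν * constSigma d τ cΦ (Φ 0) cq ν)) *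
        Real.exp (cq * ν * constTheta d τ cΦ (Φ 0) cq ν) * (1 + ν * cq) ^ d := by
        gcongr
        linarith
    _ = 2 * constK d τ cΦ (Φ 0) cq ν * Real.exp (cq * ν * constTheta d τ cΦ (Φ 0) cq ν) *
        (1 + ν * cq) ^ d * constSigma d τ cΦ (Φ 0) cq ν := by ring
    _ ≤ _ := by
        gcongr
        exact le_constC hΦ hd hw

theorem two_pow_le_constC_mul_constSigma (hΦ : IsKernel Φ τ cΦ CΦ) (hd : 1 ≤ d) (hw : 0 ≤ ν * cq) :
    2 ^ d ≤ constC d τ cΦ (Φ 0) cq ν * constSigma d τ cΦ (Φ 0) cq ν := by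
  have hθ := constTheta_pos hΦ hd (cq := cq) (ν := ν)
  refine le_trans ?_ (le_constC_mul_constSigma hΦ hd hw)
  have h1 : 1 ≤ Real.exp (cq * ν * constTheta d τ cΦ (Φ 0) cq ν) :=
    Real.one_le_exp (by rw [mul_comm cq]; positivity)
  have h2 : (1 : ℝ) ≤ (1 + ν * cq) ^ d := one_le_pow₀ (by linarith)
  rw [mul_assoc]
  exact le_mul_of_one_le_right (by positivity) (one_le_mul_of_one_le_of_one_le h1 h2)

theorem sum_abs_kernelRow_le (hΦ : IsKernel Φ τ cΦ CΦ) (hd : 1 ≤ d) (hδ : 0 < δ) (hq : 0 < q)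
    (hsep : ∀ i j, i ≠ j → 2 * q ≤ ‖x i - x j‖) (hw : δ ≤ ν * cq * q)
    (y : EuclideanSpace ℝ (Fin d)) :
    ∑ j, |kernelRow Φ δ x y j| ≤
      constC d τ cΦ (Φ 0) cq ν * constSigma d τ cΦ (Φ 0) cq ν := by
  have hθ := constTheta_pos hΦ hd (cq := cq) (ν := ν)
  have hwq : δ / q ≤ ν * cq := by rwa [div_le_iff₀ hq]
  have hw0 : 0 < ν * cq := lt_of_lt_of_le (by positivity) hwq
  rcases le_or_gt δ (2 * q) with hqδ | hqδ
  · refine (Finset.sum_le_sum fun j _ => abs_kernelRow_le_of_le hΦ hd hδ hsep hqδ y j).trans ?_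
    refine (sum_ite_norm_lt_le hδ hq hsep hw y _).trans ?_
    refine le_trans ?_ (le_constC_mul_constSigma hΦ hd hw0.le)
    have h1 : 1 ≤ Real.exp (cq * ν * constTheta d τ cΦ (Φ 0) cq ν) :=
      Real.one_le_exp (by rw [mul_comm cq]; positivity)
    exact le_mul_of_one_le_left (by positivity)
      (one_le_mul_of_one_le_of_one_le (one_le_pow₀ (by norm_num)) h1)
  · refine (Finset.sum_le_sum fun j _ =>
      abs_kernelRow_le_of_lt hΦ hd hδ hq hsep hw hqδ y j).trans ?_
    rw [← Finset.mul_sum]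
    have := constC_pos hΦ hd hw0.le
    gcongr
    exact sum_exp_neg_dist_le_tsum _ x y hq hθ fun i _ j _ => hsep i j

theorem sum_abs_kernelRow_le_of_far (hΦ : IsKernel Φ τ cΦ CΦ) (hd : 1 ≤ d) (hδ : 0 < δ)
    (hq : 0 < q) (hsep : ∀ i j, i ≠ j → 2 * q ≤ ‖x i - x j‖) (hw : δ ≤ ν * cq * q) {T : ℝ}
    (hT : 0 < T) (hTθ : T ^ d ≤ Real.exp (constTheta d τ cΦ (Φ 0) cq ν / 2 * T))
    (y : EuclideanSpace ℝ (Fin d)) (s : Finset ι) (hs : ∀ j ∈ s, T * q ≤ ‖x j - y‖) :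
    ∑ j ∈ s, |kernelRow Φ δ x y j| ≤
      constC d τ cΦ (Φ 0) cq ν * constSigma d τ cΦ (Φ 0) cq ν *
        (Real.exp (constTheta d τ cΦ (Φ 0) cq ν) *
          Real.exp (-(constTheta d τ cΦ (Φ 0) cq ν / 2 * T))) := by
  have hθ := constTheta_pos hΦ hd (cq := cq) (ν := ν)
  have hwq : δ / q ≤ ν * cq := by rwa [div_le_iff₀ hq]
  have hw0 : 0 < ν * cq := lt_of_lt_of_le (by positivity) hwq
  have hS := constSigma_nonneg (Φ := Φ) (d := d) (τ := τ) (cΦ := cΦ) (cq := cq) (ν := ν)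
  have hC := constC_pos hΦ hd hw0.le (cq := cq) (ν := ν)
  set θ := constTheta d τ cΦ (Φ 0) cq ν with hθdef
  rcases le_or_gt δ (2 * q) with hqδ | hqδ
  · refine (Finset.sum_le_sum fun j _ => abs_kernelRow_le_of_le hΦ hd hδ hsep hqδ y j).trans ?_
    -- A far point inside the support forces `T ≤ ν * cq`, and then `exp (cq * ν * θ)` compensates
    -- for `exp (-(θ / 2 * T))`. Otherwise the sum is zero.
    by_cases hne : ∃ j ∈ s, ‖x j - y‖ < δ
    · obtain ⟨j, hj, hjδ⟩ := hne
      have hTw : T ≤ ν * cq := by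
        refine le_trans ?_ hwq
        rw [le_div_iff₀ hq]
        exact (hs j hj).trans hjδ.le
      refine (sum_ite_norm_lt_le hδ hq hsep hw y _).trans ?_
      have h1 := le_constC_mul_constSigma hΦ hd hw0.le
      have h2 : 1 ≤ Real.exp (cq * ν * θ) *
          (Real.exp θ * Real.exp (-(θ / 2 * T))) := by
        rw [← Real.exp_add, ← Real.exp_add]
        refine Real.one_le_exp ?_
        nlinarith
      calc (1 + ν * cq) ^ d
          ≤ 2 ^ d * (1 + ν * cq) ^ d * (Real.exp (cq * ν * θ) *
          (Real.exp θ * Real.exp (-(θ / 2 * T)))) := by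
            have h3 : (1 : ℝ) ≤ 2 ^ d := one_le_pow₀ (by norm_num)
            have h4 : (1 + ν * cq) ^ d ≤ 2 ^ d * (1 + ν * cq) ^ d :=
              le_mul_of_one_le_left (by positivity) h3
            exact h4.trans (le_mul_of_one_le_right (by positivity) h2)
        _ = (2 ^ d * Real.exp (cq * ν * θ) * (1 + ν * cq) ^ d) *
          (Real.exp θ * Real.exp (-(θ / 2 * T))) := by ring
        _ ≤ _ := by gcongr
    · push Not at hne
      rw [Finset.sum_eq_zero fun j hj => if_neg (not_lt.mpr (hne j hj))]
      positivity
  · refine (Finset.sum_le_sum fun j _ =>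
      abs_kernelRow_le_of_lt hΦ hd hδ hq hsep hw hqδ y j).trans ?_
    rw [← Finset.mul_sum, mul_assoc]
    gcongr
    rw [mul_comm]
    exact sum_exp_neg_dist_le_of_far _ x y hq hθ hT hTθ (fun i _ j _ => hsep i j) hs

end Level

end Multiscale

namespace Multiscale

/-! ### Point sequences -/

theorem norm_sub_ge_separationDistance {d n : ℕ} (x : Fin n → EuclideanSpace ℝ (Fin d))
    {i j : Fin n} (hij : i ≠ j) : 2 * separationDistance x ≤ ‖x i - x j‖ := by
  have h := ciInf_le (f := fun p : {p : Fin n × Fin n // p.1 ≠ p.2} => ‖x p.1.1 - x p.1.2‖)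
    ⟨0, by rintro _ ⟨p, rfl⟩; exact norm_nonneg _⟩ ⟨(i, j), hij⟩
  unfold separationDistance
  linarith

theorem separationDistance_nonneg {d n : ℕ} (x : Fin n → EuclideanSpace ℝ (Fin d)) :
    0 ≤ separationDistance x :=
  mul_nonneg (by norm_num) (Real.iInf_nonneg fun _ => norm_nonneg _)

theorem bddAbove_iInf_norm {d n : ℕ} {Ω : Set (EuclideanSpace ℝ (Fin d))}
    (hΩ : Bornology.IsBounded Ω) (hn : 0 < n) (x : Fin n → EuclideanSpace ℝ (Fin d)) :
    BddAbove (Set.range fun y : Ω => ⨅ j : Fin n, ‖(y : EuclideanSpace ℝ (Fin d)) - x j‖) := by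
  obtain ⟨R, hR⟩ := hΩ.subset_closedBall (x ⟨0, hn⟩)
  refine ⟨R, ?_⟩
  rintro _ ⟨y, rfl⟩
  refine (ciInf_le ⟨0, by rintro _ ⟨p, rfl⟩; exact norm_nonneg _⟩ ⟨0, hn⟩).trans ?_
  rw [← dist_eq_norm]
  exact hR y.2

theorem exists_norm_sub_le_fillDistance {d n : ℕ} {Ω : Set (EuclideanSpace ℝ (Fin d))}
    (hΩ : Bornology.IsBounded Ω) (hn : 0 < n) (x : Fin n → EuclideanSpace ℝ (Fin d))
    {y : EuclideanSpace ℝ (Fin d)} (hy : y ∈ Ω) : ∃ j, ‖y - x j‖ ≤ fillDistance Ω x := by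
  have : Nonempty (Fin n) := ⟨⟨0, hn⟩⟩
  obtain ⟨j, hj⟩ := exists_eq_ciInf_of_finite (f := fun j => ‖y - x j‖)
  refine ⟨j, hj.le.trans ?_⟩
  exact le_ciSup (bddAbove_iInf_norm hΩ hn x) ⟨y, hy⟩

/-- A nonempty open set in positive dimension is infinite, so some point of it is not a node. -/
theorem fillDistance_pos {d n : ℕ} (hd : 1 ≤ d) {Ω : Set (EuclideanSpace ℝ (Fin d))}
    (ho : IsOpen Ω) (hne : Ω.Nonempty) (hΩ : Bornology.IsBounded Ω) (hn : 0 < n)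
    (x : Fin n → EuclideanSpace ℝ (Fin d)) : 0 < fillDistance Ω x := by
  have : Nonempty (Fin d) := ⟨⟨0, hd⟩⟩
  have hinf : Ω.Infinite := by
    obtain ⟨y, hy⟩ := hne
    exact infinite_of_mem_nhds y (ho.mem_nhds hy)
  obtain ⟨y, hy, hyx⟩ := hinf.exists_notMem_finset (Finset.univ.image x)
  obtain ⟨j, hj⟩ := exists_norm_sub_le_fillDistance hΩ hn x hy
  refine lt_of_lt_of_le (norm_pos_iff.mpr (sub_ne_zero.mpr ?_)) hj
  rintro rfl
  exact hyx (Finset.mem_image_of_mem x (Finset.mem_univ j))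

/-! ### Consequences of quasi-uniformity -/

namespace IsPointSequence

variable {d : ℕ} {Ω : Set (EuclideanSpace ℝ (Fin d))} {N : ℕ → ℕ}
  {x : (ℓ : ℕ) → Fin (N ℓ) → EuclideanSpace ℝ (Fin d)} {μ ch cq ν : ℝ}

/-- For `d = 0` the condition `2 < (μ ^ d)⁻¹` would read `2 < 1`. -/
theorem one_le_dim (hX : IsPointSequence Ω N x μ ch cq ν) : 1 ≤ d := by
  by_contra h
  have h0 : d = 0 := by omega
  have := hX.μ_pow
  rw [h0] at this
  norm_num at this

theorem card_pos (hX : IsPointSequence Ω N x μ ch cq ν) {ℓ : ℕ} (hℓ : 1 ≤ ℓ) : 0 < N ℓ := by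
  obtain ⟨c, hc, h⟩ := hX.card_lower
  have hμ := hX.μ_pos
  have : (0 : ℝ) < N ℓ := lt_of_lt_of_le (by positivity) (h ℓ hℓ)
  exact_mod_cast this

theorem fill_pos (hX : IsPointSequence Ω N x μ ch cq ν) {ℓ : ℕ} (hℓ : 1 ≤ ℓ) :
    0 < fillDistance Ω (x ℓ) :=
  fillDistance_pos hX.one_le_dim hX.isOpen hX.nonempty hX.bounded (hX.card_pos hℓ) _

theorem sep_pos (hX : IsPointSequence Ω N x μ ch cq ν) {ℓ : ℕ} (hℓ : 1 ≤ ℓ) :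
    0 < separationDistance (x ℓ) := by
  refine (separationDistance_nonneg (x ℓ)).lt_of_ne fun h => ?_
  have h1 := hX.fill_le_sep ℓ hℓ
  rw [← h, mul_zero] at h1
  exact absurd (hX.fill_pos hℓ) (not_lt.mpr h1)

theorem one_le_cq (hX : IsPointSequence Ω N x μ ch cq ν) : 1 ≤ cq := by
  have h := (hX.sep_le_fill 1 le_rfl).trans (hX.fill_le_sep 1 le_rfl)
  exact le_of_mul_le_mul_right (by rwa [one_mul]) (hX.sep_pos le_rfl)

theorem ν_pos (hX : IsPointSequence Ω N x μ ch cq ν) : 0 < ν :=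
  lt_of_lt_of_le (one_div_pos.mpr (hX.fill_pos le_rfl)) hX.ν_lower

theorem width_pos (hX : IsPointSequence Ω N x μ ch cq ν) {ℓ : ℕ} (hℓ : 1 ≤ ℓ) :
    0 < width Ω x ν ℓ := mul_pos hX.ν_pos (hX.fill_pos hℓ)

theorem width_le (hX : IsPointSequence Ω N x μ ch cq ν) {ℓ : ℕ} (hℓ : 1 ≤ ℓ) :
    width Ω x ν ℓ ≤ ν * cq * separationDistance (x ℓ) := by
  have := hX.ν_pos
  rw [width, mul_assoc]
  gcongr
  exact hX.fill_le_sep ℓ hℓ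

theorem chμ_pos (hX : IsPointSequence Ω N x μ ch cq ν) : 0 < ch * μ := mul_pos hX.ch_pos hX.μ_pos

theorem chμ_le_one (hX : IsPointSequence Ω N x μ ch cq ν) : ch * μ ≤ 1 :=
  mul_le_one₀ hX.ch_le hX.μ_pos.le hX.μ_lt.le

theorem pow_mul_fill_le (hX : IsPointSequence Ω N x μ ch cq ν) (b : ℕ) :
    (ch * μ) ^ b * fillDistance Ω (x 1) ≤ fillDistance Ω (x (b + 1)) := by
  induction b with
  | zero => simp
  | succ b ih =>
    refine le_trans ?_ (hX.fill_lower (b + 1) (by omega))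
    rw [pow_succ', mul_assoc]
    exact mul_le_mul_of_nonneg_left ih hX.chμ_pos.le

/-- The number of points on a level in terms of the number of points on the first level. -/
theorem card_le (hX : IsPointSequence Ω N x μ ch cq ν) (b : ℕ) :
    (N (b + 1) : ℝ) ≤ N 1 * (2 * cq * ((ch * μ) ^ b)⁻¹) ^ d := by
  classical
  have hP := hX.chμ_pos
  have hq := hX.sep_pos (ℓ := b + 1) (by omega)
  have hh := hX.fill_pos le_rfl
  -- Each point is assigned to a point of the first level within `h_1`, and packing bounds every
  -- fibre.
  choose g hg using fun i : Fin (N (b + 1)) =>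
    exists_norm_sub_le_fillDistance hX.bounded (hX.card_pos le_rfl) (x 1)
      (hX.mem (b + 1) (by omega) i)
  have hfib : ∀ j : Fin (N 1), ((Finset.univ.filter fun i => g i = j).card : ℝ) ≤
      (2 * cq * ((ch * μ) ^ b)⁻¹) ^ d := by
    intro j
    refine (card_le_of_separated _ (x (b + 1)) (x 1 j) hq hh.le
      (fun i _ k _ hik => norm_sub_ge_separationDistance _ hik) fun i hi => ?_).trans ?_
    · have := hg i
      rwa [(Finset.mem_filter.mp hi).2] at this
    · have h1 : fillDistance Ω (x 1) / separationDistance (x (b + 1)) ≤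
          cq * ((ch * μ) ^ b)⁻¹ := by
        rw [div_le_iff₀ hq, mul_right_comm, ← div_eq_mul_inv, le_div_iff₀ (by positivity),
          mul_comm]
        exact (hX.pow_mul_fill_le b).trans (hX.fill_le_sep _ (by omega))
      -- This absorbs the `1` of the packing bound and produces the factor 2.
      have h2 : 1 ≤ cq * ((ch * μ) ^ b)⁻¹ :=
        one_le_mul_of_one_le_of_one_le hX.one_le_cq
          ((one_le_inv₀ (by positivity)).mpr (pow_le_one₀ hP.le hX.chμ_le_one))
      gcongr
      linarith
  have hcard := Finset.card_eq_sum_card_fiberwise (s := Finset.univ) (t := Finset.univ) (f := g)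
    fun i _ => Finset.mem_coe.mpr (Finset.mem_univ (g i))
  rw [Finset.card_univ, Fintype.card_fin] at hcard
  rw [hcard]
  push_cast
  refine (Finset.sum_le_sum fun j _ => hfib j).trans (le_of_eq ?_)
  simp

theorem card_idx_le (hX : IsPointSequence Ω N x μ ch cq ν) (L : ℕ) :
    (Fintype.card (Idx N L) : ℝ) ≤ L * (N 1 * (2 * cq * ((ch * μ) ^ (L - 1))⁻¹) ^ d) := by
  have hP := hX.chμ_pos
  have hcq := hX.one_le_cq
  rw [Fintype.card_sigma]
  push_cast
  simp only [Fintype.card_fin]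
  refine (Finset.sum_le_sum fun (b : Fin L) _ => (hX.card_le b).trans
    (show _ ≤ N 1 * (2 * cq * ((ch * μ) ^ (L - 1))⁻¹) ^ d from ?_)).trans (le_of_eq (by simp))
  have h : (ch * μ) ^ (L - 1) ≤ (ch * μ) ^ (b : ℕ) :=
    pow_le_pow_of_le_one hP.le hX.chμ_le_one (by omega)
  gcongr

end IsPointSequence

/-! ### Jacobi iterations -/

section Jacobi

variable {ι : Type} [Fintype ι]

theorem jacobi_of_fixed {M : Matrix ι ι ℝ} {y β : ι → ℝ} (h : β = y + M *ᵥ β) (m : ℕ) :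
    jacobi M y β m = β := by
  induction m with
  | zero => rfl
  | succ m ih => rw [jacobi, ih, ← h]

/-- The iterates of a nilpotent iteration do not depend on the starting vector. -/
theorem jacobi_apply_eq_of_lower {M : Matrix ι ι ℝ} {r : ι → ℕ}
    (hM : ∀ p s, r p ≤ r s → M p s = 0) (y β β' : ι → ℝ) (m : ℕ) (p : ι) (hp : r p < m) :
    jacobi M y β m p = jacobi M y β' m p := by
  induction m generalizing p with
  | zero => omega
  | succ m ih =>
    simp only [jacobi, Pi.add_apply, mulVec, dotProduct]
    congr 1
    refine Finset.sum_congr rfl fun s _ => ?_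
    rcases le_or_gt (r p) (r s) with h | h
    · rw [hM p s h, zero_mul, zero_mul]
    · rw [ih s (by omega)]

theorem abs_mulVec_le {M : Matrix ι ι ℝ} {c e : ℝ} {v : ι → ℝ} (hM : ∀ p, ∑ s, |M p s| ≤ c)
    (hv : ∀ p, |v p| ≤ e) (he : 0 ≤ e) (p : ι) : |(M *ᵥ v) p| ≤ c * e := by
  calc |(M *ᵥ v) p| ≤ ∑ s, |M p s * v s| := Finset.abs_sum_le_sum_abs _ _
    _ ≤ ∑ s, |M p s| * e := by
        refine Finset.sum_le_sum fun s _ => ?_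
        rw [abs_mul]
        exact mul_le_mul_of_nonneg_left (hv s) (abs_nonneg _)
    _ = (∑ s, |M p s|) * e := by rw [Finset.sum_mul]
    _ ≤ c * e := mul_le_mul_of_nonneg_right (hM p) he

/-- The start at zero keeps the iterates bounded by the right-hand side alone. At `m = 0` the
truncated exponent is harmless because of the factor `m`. -/
theorem abs_jacobi_zero_le {M : Matrix ι ι ℝ} {y : ι → ℝ} {Y F : ℝ} (hY : 1 ≤ Y) (hF : 0 ≤ F)
    (hM : ∀ p, ∑ s, |M p s| ≤ Y) (hy : ∀ p, |y p| ≤ F) (m : ℕ) (p : ι) :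
    |jacobi M y 0 m p| ≤ F * (m * Y ^ (m - 1)) := by
  induction m generalizing p with
  | zero => simp [jacobi]
  | succ m ih =>
    rw [jacobi, Pi.add_apply]
    have h1 := abs_mulVec_le hM ih (by positivity) p
    have h2 : Y * (F * (m * Y ^ (m - 1))) = F * (m * Y ^ m) := by
      rcases m with _ | m
      · simp
      · rw [Nat.add_sub_cancel, pow_succ]; ring
    rw [h2] at h1
    refine (abs_add_le _ _).trans ((add_le_add (hy p) h1).trans ?_)
    have h3 : 1 ≤ Y ^ m := one_le_pow₀ hY
    rw [Nat.add_sub_cancel, Nat.cast_add_one, add_mul, one_mul, mul_add, add_comm]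
    gcongr
    exact le_mul_of_one_le_right hF h3

/-- Perturbation bound for the Jacobi iteration in the maximum norm. -/
theorem abs_jacobi_sub_jacobi_le {M M' : Matrix ι ι ℝ} {y : ι → ℝ} {Y F η : ℝ} (hY : 1 ≤ Y)
    (hF : 0 ≤ F) (hη : 0 ≤ η) (hM : ∀ p, ∑ s, |M p s| ≤ Y) (hM' : ∀ p, ∑ s, |M' p s| ≤ Y)
    (hE : ∀ p, ∑ s, |(M - M') p s| ≤ Y * η) (hy : ∀ p, |y p| ≤ F) (m : ℕ) (p : ι) :
    |jacobi M y 0 m p - jacobi M' y 0 m p| ≤ η * F * (m ^ 2 * Y ^ (m - 1)) := by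
  induction m generalizing p with
  | zero => simp [jacobi]
  | succ m ih =>
    have hpow : ∀ c : ℝ, c * (m * Y ^ (m - 1)) * Y = c * (m * Y ^ m) := by
      intro c
      rcases m with _ | m
      · simp
      · rw [Nat.add_sub_cancel, pow_succ]; ring
    -- The old error is propagated by `M`; the new error is the perturbation applied to the iterate
    -- of `M'`.
    have hsplit : jacobi M y 0 (m + 1) p - jacobi M' y 0 (m + 1) p =
        (M *ᵥ fun s => jacobi M y 0 m s - jacobi M' y 0 m s) p +
          ((M - M') *ᵥ jacobi M' y 0 m) p := by
      have : (fun s => jacobi M y 0 m s - jacobi M' y 0 m s) =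
        jacobi M y 0 m - jacobi M' y 0 m := rfl
      rw [this, jacobi, jacobi, mulVec_sub, sub_mulVec]
      simp only [Pi.add_apply, Pi.sub_apply]
      ring
    rw [hsplit]
    have h1 := abs_mulVec_le hM ih (by positivity) p
    have h2 := abs_mulVec_le hE (abs_jacobi_zero_le hY hF hM' hy m) (by positivity) p
    refine (abs_add_le _ _).trans ((add_le_add h1 h2).trans ?_)
    rw [Nat.add_sub_cancel, Nat.cast_add_one]
    calc Y * (η * F * (m ^ 2 * Y ^ (m - 1))) + Y * η * (F * (m * Y ^ (m - 1)))
        = η * F * m * (m * Y ^ (m - 1)) * Y + η * F * (m * Y ^ (m - 1)) * Y := by ring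
      _ = η * F * (((m : ℝ) ^ 2 + m) * Y ^ m) := by rw [hpow, hpow]; ring
      _ ≤ η * F * (((m : ℝ) + 1) ^ 2 * Y ^ m) := by
          gcongr
          have : (0 : ℝ) ≤ m := by positivity
          nlinarith

theorem norm_toLp_le_sqrt_card_mul {v : ι → ℝ} {e : ℝ} (he : 0 ≤ e) (hv : ∀ p, |v p| ≤ e) :
    ‖WithLp.toLp 2 v‖ ≤ √(Fintype.card ι) * e := by
  rw [EuclideanSpace.norm_eq, ← Real.sqrt_sq he, ← Real.sqrt_mul (by positivity)]
  refine Real.sqrt_le_sqrt ?_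
  calc ∑ p, ‖v p‖ ^ 2 ≤ ∑ _p : ι, e ^ 2 := by
        refine Finset.sum_le_sum fun p _ => ?_
        have := hv p
        rw [Real.norm_eq_abs]
        gcongr
    _ = _ := by simp

end Jacobi

/-! ### The multiscale matrices -/

theorem sum_fin_le {L : ℕ} {g : Fin L → ℝ} {c : ℝ} (h : ∀ b, g b ≤ c) : ∑ b, g b ≤ L * c := by
  simpa using Finset.sum_le_card_nsmul Finset.univ g c fun b _ => h b

section MultiscaleMatrix

variable {d : ℕ} {Φ : EuclideanSpace ℝ (Fin d) → ℝ} {τ cΦ CΦ : ℝ}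
  {Ω : Set (EuclideanSpace ℝ (Fin d))} {N : ℕ → ℕ}
  {x : (ℓ : ℕ) → Fin (N ℓ) → EuclideanSpace ℝ (Fin d)} {μ ch cq ν : ℝ} {L : ℕ}

theorem matM_apply (p r : Idx N L) :
    matM Φ Ω x ν L p r =
      if r.1 < p.1 then
        -kernelRow Φ (width Ω x ν ((r.1 : ℕ) + 1)) (x ((r.1 : ℕ) + 1)) (node x p) r.2
      else 0 := by
  rw [matM, Matrix.sub_apply, matT, Matrix.of_apply]
  split_ifs with h h'
  · have : p ≠ r := by rintro rfl; exact lt_irrefl _ h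
    rw [Matrix.one_apply_ne this, zero_sub]
    rfl
  · rw [h', Matrix.one_apply_eq, sub_self]
  · rw [Matrix.one_apply_ne h', sub_self]

theorem matM_eq_zero {p r : Idx N L} (h : (p.1 : ℕ) ≤ r.1) : matM Φ Ω x ν L p r = 0 := by
  rw [matM_apply, if_neg (not_lt.mpr (Fin.le_def.mpr h))]

theorem abs_matMThreshold_le (T : ℝ) (p r : Idx N L) :
    |matMThreshold Φ Ω x ν L T p r| ≤ |matM Φ Ω x ν L p r| := by
  rw [matMThreshold, Matrix.of_apply]
  split_ifs
  · rfl
  · simp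

theorem sum_abs_matM_le (hΦ : IsKernel Φ τ cΦ CΦ) (hX : IsPointSequence Ω N x μ ch cq ν)
    (p : Idx N L) :
    ∑ r, |matM Φ Ω x ν L p r| ≤
      L * (constC d τ cΦ (Φ 0) cq ν * constSigma d τ cΦ (Φ 0) cq ν) := by
  rw [Fintype.sum_sigma]
  refine sum_fin_le fun b => ?_
  refine le_trans (Finset.sum_le_sum fun j _ => ?_) (sum_abs_kernelRow_le hΦ hX.one_le_dim
    (hX.width_pos (ℓ := (b : ℕ) + 1) (by omega)) (hX.sep_pos (by omega))
    (fun i j => norm_sub_ge_separationDistance (x ((b : ℕ) + 1))) (hX.width_le (by omega))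
    (node x p))
  rw [matM_apply]
  split_ifs
  · rw [abs_neg]
  · rw [abs_zero]; exact abs_nonneg _

theorem sum_abs_matM_sub_le (hΦ : IsKernel Φ τ cΦ CΦ) (hX : IsPointSequence Ω N x μ ch cq ν)
    {T : ℝ} (hT : 0 < T) (hTθ : T ^ d ≤ Real.exp (constTheta d τ cΦ (Φ 0) cq ν / 2 * T))
    (p : Idx N L) :
    ∑ r, |(matM Φ Ω x ν L - matMThreshold Φ Ω x ν L T) p r| ≤
      L * (constC d τ cΦ (Φ 0) cq ν * constSigma d τ cΦ (Φ 0) cq ν) *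
        (Real.exp (constTheta d τ cΦ (Φ 0) cq ν) *
          Real.exp (-(constTheta d τ cΦ (Φ 0) cq ν / 2 * T))) := by
  classical
  rw [Fintype.sum_sigma, mul_assoc]
  refine sum_fin_le fun b => ?_
  set s := Finset.univ.filter fun j : Fin (N ((b : ℕ) + 1)) =>
    T * separationDistance (x ((b : ℕ) + 1)) ≤ ‖x ((b : ℕ) + 1) j - node x p‖ with hs
  refine le_trans ?_ (sum_abs_kernelRow_le_of_far hΦ hX.one_le_dim
    (hX.width_pos (ℓ := (b : ℕ) + 1) (by omega)) (hX.sep_pos (by omega))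
    (fun i j => norm_sub_ge_separationDistance (x ((b : ℕ) + 1))) (hX.width_le (by omega)) hT hTθ
    (node x p) s fun j hj => (Finset.mem_filter.mp hj).2)
  rw [hs, Finset.sum_filter]
  refine Finset.sum_le_sum fun j _ => ?_
  have hnode : ‖node x p - node x (⟨b, j⟩ : Idx N L)‖ = ‖x ((b : ℕ) + 1) j - node x p‖ :=
    norm_sub_rev _ _
  rw [Matrix.sub_apply, matMThreshold, Matrix.of_apply, hnode]
  split_ifs with h1 h2 h2
  · exact absurd h1 (not_lt.mpr h2)
  · simp
  · rw [sub_zero, matM_apply]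
    split_ifs
    · rw [abs_neg]
    · rw [abs_zero]; exact abs_nonneg _
  · exact absurd (not_lt.mp h1) h2

/-- By continuity a violation at one point would persist on a nonempty open set, which has positive
measure. -/
theorem abs_le_eLpNorm_top {f : EuclideanSpace ℝ (Fin d) → ℝ} (hΩ : IsOpen Ω)
    (hf : ContinuousOn f Ω) (hf_bdd : MemLp f ⊤ (volume.restrict Ω))
    {y : EuclideanSpace ℝ (Fin d)} (hy : y ∈ Ω) :
    |f y| ≤ (eLpNorm f ⊤ (volume.restrict Ω)).toReal := by
  by_contra! h
  set c := (eLpNorm f ⊤ (volume.restrict Ω)).toReal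
  have hopen : IsOpen (Ω ∩ {z | c < |f z|}) :=
    hf.abs.isOpen_inter_preimage hΩ isOpen_Ioi
  have hpos : 0 < volume (Ω ∩ {z | c < |f z|}) := hopen.measure_pos _ ⟨y, hy, h⟩
  have hae := ae_le_eLpNormEssSup (f := f) (μ := volume.restrict Ω)
  rw [ae_restrict_iff' hΩ.measurableSet] at hae
  refine hpos.ne' (measure_mono_null (fun z hz => ?_) (ae_iff.mp hae))
  simp only [Set.mem_ofPred_eq, Classical.not_imp, not_le]
  refine ⟨hz.1, ?_⟩
  rw [← eLpNorm_exponent_top, ← ENNReal.ofReal_toReal hf_bdd.eLpNorm_ne_top, ← ofReal_norm,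
    Real.norm_eq_abs]
  exact (ENNReal.ofReal_lt_ofReal_iff_of_nonneg ENNReal.toReal_nonneg).mpr hz.2

/-- The final comparison of the constants. -/
theorem sqrt_mul_le_inv_pow {L : ℕ} (hL : 1 ≤ L) {S θ P : ℝ} (hS : 2 ^ d ≤ S) (hP : 0 < P)
    (hP1 : P ≤ 1) (hcq : 1 ≤ cq)
    (h : 2 * S * L * Real.exp (θ / L) * cq ^ ((d : ℝ) / (2 * L) + (d : ℝ) / 2) ≤
      P ^ (-((d : ℝ) * L / 2))) :
    √(L * (2 * cq * (P ^ (L - 1))⁻¹) ^ d) * (Real.exp θ * (L ^ 2 * (L * S) ^ (L - 1))) ≤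
      (P ^ (d * L ^ 2))⁻¹ := by
  have hL0 : (0 : ℝ) < L := by exact_mod_cast hL
  have hS1 : 1 ≤ S := le_trans (one_le_pow₀ (by norm_num)) hS
  have hcq0 : 0 < cq := by linarith
  have e1 : Real.exp (θ / L) ^ (2 * L) = Real.exp θ ^ 2 := by
    rw [← Real.exp_nat_mul, ← Real.exp_nat_mul]; congr 1; push_cast; field_simp
  have e2 : (cq ^ ((d : ℝ) / (2 * L) + (d : ℝ) / 2)) ^ (2 * L) = cq ^ (d + d * L) := by
    rw [← Real.rpow_natCast, ← Real.rpow_mul hcq0.le, ← Real.rpow_natCast]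
    congr 1; push_cast; field_simp
  have e3 : (P ^ (-((d : ℝ) * L / 2))) ^ (2 * L) = (P ^ (d * L ^ 2))⁻¹ := by
    rw [← Real.rpow_natCast, ← Real.rpow_mul hP.le, ← Real.rpow_natCast, ← Real.rpow_neg hP.le]
    congr 1; push_cast; field_simp
  -- The power `2 L` clears the denominators of all exponents and matches the squared form of the
  -- claim.
  have h2 := pow_le_pow_left₀ (by positivity) h (2 * L)
  rw [mul_pow _ (cq ^ _), mul_pow _ (Real.exp _), e1, e2, e3] at h2
  refine le_of_sq_le_sq ?_ (by positivity)
  rw [mul_pow, Real.sq_sqrt (by positivity)]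
  set Q := (P ^ (d * L ^ 2))⁻¹ with hQ
  have hQ1 : ((P ^ (L - 1))⁻¹) ^ d ≤ Q := by
    rw [inv_pow, ← pow_mul, hQ]
    refine inv_anti₀ (by positivity) (pow_le_pow_of_le_one hP.le hP1 ?_)
    rw [mul_comm]
    gcongr
    have : L ≤ L ^ 2 := Nat.le_self_pow (by norm_num) L
    omega
  have hL3 : ((L : ℝ)) ^ 3 ≤ 4 ^ L := by
    have : ∀ k : ℕ, k ^ 3 ≤ 4 ^ k := by
      intro k
      rcases Nat.lt_or_ge k 4 with hk | hk
      · interval_cases k <;> norm_num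
      · induction k, hk using Nat.le_induction with
        | base => norm_num
        | succ k hk ih =>
          rw [pow_succ 4]
          nlinarith [Nat.mul_le_mul hk hk]
    exact_mod_cast this L
  have hexp : ((L : ℝ) * S) ^ (L - 1) * (L * S) = (L * S) ^ L := by
    rw [← pow_succ]; congr 1; omega
  -- Passing from exponent `L - 1` to `L` leaves a factor `L ^ 2 * S ^ 2`, and the 2 leaves `4 ^ L`.
  -- These cover `L ^ 2`, `2 ^ d` and `L ^ 3` respectively.
  have hmain : (L : ℝ) ^ 5 * 2 ^ d * ((L * S) ^ (L - 1)) ^ 2 ≤ (2 * S * L) ^ (2 * L) := by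
    have h3 : (2 * S * L) ^ (2 * L) = 4 ^ L * (((L : ℝ) * S) ^ (L - 1) * (L * S)) ^ 2 := by
      rw [hexp, show 2 * S * (L : ℝ) = 2 * (L * S) by ring, mul_pow, pow_mul, ← pow_mul _ L 2,
        mul_comm L 2]
      norm_num
    rw [h3]
    have h4 : (2 : ℝ) ^ d ≤ S ^ 2 := by nlinarith
    calc (L : ℝ) ^ 5 * 2 ^ d * ((L * S) ^ (L - 1)) ^ 2
        = (L : ℝ) ^ 3 * 2 ^ d * (((L * S) ^ (L - 1)) ^ 2 * L ^ 2) := by ring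
      _ ≤ 4 ^ L * S ^ 2 * (((L * S) ^ (L - 1)) ^ 2 * L ^ 2) := by gcongr
      _ = _ := by ring
  have hcqd : cq ^ d ≤ cq ^ (d + d * L) := pow_le_pow_right₀ hcq (by omega)
  calc L * (2 * cq * (P ^ (L - 1))⁻¹) ^ d * (Real.exp θ * (L ^ 2 * (L * S) ^ (L - 1))) ^ 2
      = ((L : ℝ) ^ 5 * 2 ^ d * ((L * S) ^ (L - 1)) ^ 2) * Real.exp θ ^ 2 * cq ^ d *
          ((P ^ (L - 1))⁻¹) ^ d := by
        rw [mul_pow, mul_pow 2 cq]; ring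
    _ ≤ (2 * S * L) ^ (2 * L) * Real.exp θ ^ 2 * cq ^ (d + d * L) * Q := by gcongr
    _ ≤ Q * Q := by gcongr
    _ = Q ^ 2 := by ring

theorem norm_jacobi_sub_jacobi_le (hΦ : IsKernel Φ τ cΦ CΦ)
    (hX : IsPointSequence Ω N x μ ch cq ν) (hL : 1 ≤ L) {T : ℝ} (hT : 0 < T)
    (hL_large :
      2 * constC d τ cΦ (Φ 0) cq ν * constSigma d τ cΦ (Φ 0) cq ν * L *
          Real.exp (constTheta d τ cΦ (Φ 0) cq ν / L) *
          cq ^ ((d : ℝ) / (2 * L) + (d : ℝ) / 2)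
        ≤ (ch * μ) ^ (-((d : ℝ) * L / 2)))
    (hT_large : T ^ d ≤ Real.exp (constTheta d τ cΦ (Φ 0) cq ν / 2 * T))
    {f : EuclideanSpace ℝ (Fin d) → ℝ} {F : ℝ} (hF : 0 ≤ F) (hf : ∀ y ∈ Ω, |f y| ≤ F) :
    ‖WithLp.toLp 2 (jacobi (matM Φ Ω x ν L) (rhs x L f) 0 L -
        jacobi (matMThreshold Φ Ω x ν L T) (rhs x L f) 0 L)‖ ≤
      √(N 1 : ℝ) * Real.exp (-(constTheta d τ cΦ (Φ 0) cq ν / 2 * T)) *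
        ((ch * μ) ^ (d * L ^ 2))⁻¹ * F := by
  have hd := hX.one_le_dim
  have hcq := hX.one_le_cq
  have hP := hX.chμ_pos
  have hS := two_pow_le_constC_mul_constSigma hΦ hd (cq := cq) (ν := ν)
    (mul_nonneg hX.ν_pos.le (by linarith))
  set S := constC d τ cΦ (Φ 0) cq ν * constSigma d τ cΦ (Φ 0) cq ν with hSdef
  set θ := constTheta d τ cΦ (Φ 0) cq ν with hθ
  have hS1 : 1 ≤ S := le_trans (one_le_pow₀ (by norm_num)) hS
  have hL1 : (1 : ℝ) ≤ L := by exact_mod_cast hL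
  have hM := sum_abs_matM_le (L := L) hΦ hX
  have hv := abs_jacobi_sub_jacobi_le (one_le_mul_of_one_le_of_one_le hL1 hS1) hF
    (show 0 ≤ Real.exp θ * Real.exp (-(θ / 2 * T)) by positivity) hM
    (fun p => (Finset.sum_le_sum fun r _ => abs_matMThreshold_le T p r).trans (hM p))
    (sum_abs_matM_sub_le hΦ hX hT hT_large)
    (fun p => hf _ (hX.mem _ (by omega) p.2) : ∀ p, |rhs x L f p| ≤ F) L
  refine (norm_toLp_le_sqrt_card_mul (by positivity) hv).trans ?_
  have hfinal := sqrt_mul_le_inv_pow (d := d) hL hS hP hX.chμ_le_one hcq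
    (by rw [hSdef, ← mul_assoc]; exact hL_large)
  have hsqrt : √(Fintype.card (Idx N L)) ≤
      √(N 1 : ℝ) * √(L * (2 * cq * ((ch * μ) ^ (L - 1))⁻¹) ^ d) := by
    rw [← Real.sqrt_mul (by positivity)]
    refine Real.sqrt_le_sqrt ((hX.card_idx_le L).trans (le_of_eq (by ring)))
  calc √(Fintype.card (Idx N L)) *
        (Real.exp θ * Real.exp (-(θ / 2 * T)) * F * (L ^ 2 * (L * S) ^ (L - 1)))
      ≤ √(N 1 : ℝ) * √(L * (2 * cq * ((ch * μ) ^ (L - 1))⁻¹) ^ d) *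
        (Real.exp θ * Real.exp (-(θ / 2 * T)) * F * (L ^ 2 * (L * S) ^ (L - 1))) := by gcongr
    _ = √(N 1 : ℝ) * Real.exp (-(θ / 2 * T)) * (√(L * (2 * cq * ((ch * μ) ^ (L - 1))⁻¹) ^ d) *
        (Real.exp θ * (L ^ 2 * (L * S) ^ (L - 1)))) * F := by ring
    _ ≤ _ := by gcongr

theorem jacobi_matM_eq (y β β' : Idx N L → ℝ) :
    jacobi (matM Φ Ω x ν L) y β L = jacobi (matM Φ Ω x ν L) y β' L := by
  ext p
  exact jacobi_apply_eq_of_lower (r := fun p : Idx N L => (p.1 : ℕ))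
    -- Blocks are numbered from `0` to `L - 1`, so exactly `L` steps settle all of them.
    (fun p s h => matM_eq_zero h) y β β' L p p.1.2

theorem jacobi_matMThreshold_eq (T : ℝ) (y β β' : Idx N L → ℝ) :
    jacobi (matMThreshold Φ Ω x ν L T) y β L = jacobi (matMThreshold Φ Ω x ν L T) y β' L := by
  ext p
  refine jacobi_apply_eq_of_lower (r := fun p : Idx N L => (p.1 : ℕ))
    (fun p s h => ?_) y β β' L p p.1.2
  have h1 := abs_matMThreshold_le (Φ := Φ) (Ω := Ω) (x := x) (ν := ν) T p s
  rw [matM_eq_zero h, abs_zero] at h1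
  exact abs_nonpos_iff.mp h1

end MultiscaleMatrix

end Multiscale

theorem theorem4p6 {d : ℕ} (Φ : EuclideanSpace ℝ (Fin d) → ℝ) (τ cΦ CΦ : ℝ)
    (hΦ : Multiscale.IsKernel Φ τ cΦ CΦ)
    (Ω : Set (EuclideanSpace ℝ (Fin d))) (N : ℕ → ℕ)
    (x : (ℓ : ℕ) → Fin (N ℓ) → EuclideanSpace ℝ (Fin d)) (μ ch cq ν : ℝ)
    (hX : Multiscale.IsPointSequence Ω N x μ ch cq ν)
    (L : ℕ) (hL : 1 ≤ L) (T : ℝ) (hT : 0 < T)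
    (hL_large :
      2 * Multiscale.constC d τ cΦ (Φ 0) cq ν * Multiscale.constSigma d τ cΦ (Φ 0) cq ν * L *
          Real.exp (Multiscale.constTheta d τ cΦ (Φ 0) cq ν / L) *
          cq ^ ((d : ℝ) / (2 * L) + (d : ℝ) / 2)
        ≤ (ch * μ) ^ (-((d : ℝ) * L / 2)))
    (hT_large : T ^ d ≤ Real.exp (Multiscale.constTheta d τ cΦ (Φ 0) cq ν / 2 * T))
    (f : EuclideanSpace ℝ (Fin d) → ℝ) (hf : ContinuousOn f Ω)
    (hf_bdd : MemLp f ⊤ (volume.restrict Ω)) :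
    (∀ β₀ : Multiscale.Idx N L → ℝ,
      ‖WithLp.toLp 2
          (Multiscale.jacobi (Multiscale.matM Φ Ω x ν L) (Multiscale.rhs x L f) β₀ L -
            Multiscale.jacobi (Multiscale.matMThreshold Φ Ω x ν L T)
              (Multiscale.rhs x L f) β₀ L)‖
        ≤ √(N 1 : ℝ) * Real.exp (-(Multiscale.constTheta d τ cΦ (Φ 0) cq ν / 2 * T)) *
            ((ch * μ) ^ (d * L ^ 2))⁻¹ * (eLpNorm f ⊤ (volume.restrict Ω)).toReal) ∧
    (∀ β β' : Multiscale.Idx N L → ℝ,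
      Multiscale.matT Φ Ω x ν L *ᵥ β = Multiscale.rhs x L f →
      (1 - Multiscale.matMThreshold Φ Ω x ν L T) *ᵥ β' = Multiscale.rhs x L f →
      ‖WithLp.toLp 2 (β - β')‖
        ≤ √(N 1 : ℝ) * Real.exp (-(Multiscale.constTheta d τ cΦ (Φ 0) cq ν / 2 * T)) *
            ((ch * μ) ^ (d * L ^ 2))⁻¹ * (eLpNorm f ⊤ (volume.restrict Ω)).toReal) := by

  have hbound := Multiscale.norm_jacobi_sub_jacobi_le hΦ hX hL hT hL_large hT_large
    ENNReal.toReal_nonneg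
    fun y hy => Multiscale.abs_le_eLpNorm_top hX.isOpen hf hf_bdd hy
  refine ⟨fun β₀ => ?_, fun β β' hβ hβ' => ?_⟩
  · rw [Multiscale.jacobi_matM_eq _ β₀ 0, Multiscale.jacobi_matMThreshold_eq T _ β₀ 0]
    exact hbound
  · have h1 : β = Multiscale.rhs x L f + Multiscale.matM Φ Ω x ν L *ᵥ β := by
      rw [Multiscale.matM, Matrix.sub_mulVec, Matrix.one_mulVec, hβ, add_sub_cancel]
    have h2 : β' = Multiscale.rhs x L f + Multiscale.matMThreshold Φ Ω x ν L T *ᵥ β' := by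
      rw [← hβ', Matrix.sub_mulVec, Matrix.one_mulVec, sub_add_cancel]
    -- Each solution is the `L`-th iterate started at itself, which equals the `L`-th iterate
    -- started at zero.
    rw [← Multiscale.jacobi_of_fixed h1 L, ← Multiscale.jacobi_of_fixed h2 L,
      Multiscale.jacobi_matM_eq _ β 0, Multiscale.jacobi_matMThreshold_eq T _ β' 0]
    exact hbound
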